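/- Let $\mathbb T=\{t\in\mathbb C:|t|=1\}$, and let $H^2(\mathbb T)$ be the closed subspace of those $f\in L^2(\mathbb T)$ whose Fourier coefficients $f_k=\frac1{2\pi}\int_0^{2\pi}f(e^{i\theta})e^{-ik\theta}\,d\theta$ vanish for all $k<0$. Let $P$ be the Riesz projection, i.e. the orthogonal projection of $L^2(\mathbb T)$ onto $H^2(\mathbb T)$, let $(Jf)(t)=t^{-1}f(t^{-1})$ be the flip operator on $L^2(\mathbb T)$, and let $M(a)$ be the operator of multiplication by $a\in L^\infty(\mathbb T)$. The Hankel operator with symbol $a\in L^\infty(\mathbb T)$ is the bounded operator $$H(a)=PM(a)J|_{H^2(\mathbb T)}:H^2(\mathbb T)\to H^2(\mathbb T).$$ For $\beta\in\mathbb C$ and $\tau=e^{i\theta_0}\in\mathbb T$ let $$u_{\beta,\tau}(e^{i\theta})=\exp\big(i\beta(\theta-\theta_0-\pi)\big),\qquad 0<\theta-\theta_0<2\pi,$$ and for $r\in[0,1)$, $\tau\in\mathbb T$ let $$(G_{r,\tau}^{-1}a)(t)=a\left(\frac{t\tau^{-1}-r}{1-rt\tau^{-1}}\right),\qquad t\in\mathbb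 T.$$ A bounded operator $A$ on a Hilbert space is called trace class if it is compact and $\|A\|_1:=\sum_n s_n(A)<\infty$, where the singular values $s_n(A)$ are the eigenvalues of $(A^*A)^{1/2}$ counted with multiplicity; $\|A\|_1$ is its trace norm. **Proposition 2.8.** For $\mu\in[0,1)$ let $$\psi_\mu^{(1)}=G_{\mu,1}^{-1}(u_{-1/2,1}-1),\qquad \psi_\mu^{(-1)}=G_{\mu,-1}^{-1}(u_{1/2,1}-1).$$ Then, for every $\mu\in[0,1)$, the operators $$H(\psi_\mu^{(1)})H(\psi_\mu^{(-1)}),\qquad H(\psi_\mu^{(-1)})H(\psi_\mu^{(1)}),\qquad H(\psi_\mu^{(1)}\psi_\mu^{(-1)})$$ are trace class operators on $H^2(\mathbb T)$, and each of them converges to zero in the trace norm as $\mu\to1$, $\mu\in[0,1)$. -/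

import Mathlib

open MeasureTheory Filter Topology
open scoped ENNReal

namespace JumpHankel

noncomputable section

/-! ### Trace class operators and the trace norm -/

section TraceClass

variable {H : Type*} [NormedAddCommGroup H] [InnerProductSpace ℂ H] [CompleteSpace H]

/-- The multiplicity of the number `s` as an eigenvalue of `|A| = (A* A)^{1/2}`, that is,
the dimension of the corresponding eigenspace (zero if `s` is not an eigenvalue). -/
def singularMultiplicity (A : H →L[ℂ] H) (s : ℝ) : ℕ∞ :=
  Cardinal.toENat
    (Module.rank ℂ (Module.End.eigenspace (CFC.abs A : H →L[ℂ] H).toLinearMap (s : ℂ)))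

/-- `‖A‖₁`, the sum of the singular values of `A`, i.e. of the eigenvalues of `|A|`, each counted
according to its multiplicity. The eigenvalue zero does not contribute. -/
def traceNorm (A : H →L[ℂ] H) : ℝ≥0∞ :=
  ∑' s : Set.Ioi (0 : ℝ), (singularMultiplicity A s : ℝ≥0∞) * ENNReal.ofReal s

/-- An operator is trace class if it is compact and the series of its singular values
converges. -/
def IsTraceClass (A : H →L[ℂ] H) : Prop :=
  IsCompactOperator A ∧ traceNorm A < ∞

end TraceClass

/-! ### Function spaces on the unit circle

The unit circle is parametrized by `t = e^{iθ}` with `θ : ℝ / 2πℤ`, and it carries the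
normalized Lebesgue measure `dθ / 2π`. -/

instance factTwoPiPos : Fact (0 < 2 * Real.pi) := ⟨Real.two_pi_pos⟩

/-- The angle variable. -/
abbrev Angles : Type := AddCircle (2 * Real.pi)

/-- The normalized Lebesgue measure. -/
abbrev arcMeasure : Measure Angles := AddCircle.haarAddCircle

/-- `L²` of the unit circle. -/
abbrev L2 : Type := Lp ℂ 2 arcMeasure

/-- `L^∞` of the unit circle. -/
abbrev LInf : Type := Lp ℂ ∞ arcMeasure

/-- The function `a` on the unit circle is (measurable and) essentially bounded. -/
def EssBounded (a : Circle → ℂ) : Prop :=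
  MemLp (fun θ : Angles => a θ.toCircle) ∞ arcMeasure

/-- The class in `L^∞` of an essentially bounded function on the unit circle. -/
def EssBounded.toLInf {a : Circle → ℂ} (ha : EssBounded a) : LInf :=
  MemLp.toLp _ ha

/-- The multiplication operator `M(a) : f ↦ a f` on `L²`. -/
def mulOp (a : LInf) : L2 →L[ℂ] L2 :=
  (ContinuousLinearMap.mul ℂ ℂ).holderL arcMeasure ∞ 2 2 a

/-- The flip operator `(J f)(t) = t⁻¹ f(t⁻¹)` on `L²`. -/
def flipOp : L2 →L[ℂ] L2 :=
  mulOp (fourierLp ∞ (-1)) ∘L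
    (Lp.compMeasurePreservingₗᵢ ℂ (fun θ : Angles => -θ)
      (Measure.measurePreserving_neg arcMeasure)).toContinuousLinearMap

/-- The Hardy space `H²`: those functions in `L²` whose Fourier coefficients with negative
index vanish. -/
def H2 : Submodule ℂ L2 where
  carrier := {f | ∀ k : ℤ, k < 0 → fourierCoeff f k = 0}
  zero_mem' := by
    intro k _
    rw [← fourierBasis_repr]
    simp
  add_mem' := by
    intro f g hf hg k hk
    have h1 := hf k hk
    have h2 := hg k hk
    rw [← fourierBasis_repr] at h1 h2 ⊢
    simp [h1, h2]
  smul_mem' := by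
    intro c f hf k hk
    have h1 := hf k hk
    rw [← fourierBasis_repr] at h1 ⊢
    simp [h1]

theorem isClosed_H2 : IsClosed (H2 : Set L2) := by
  have h : (H2 : Set L2) =
      ⋂ k : ℤ, ⋂ _ : k < 0, {f : L2 | inner ℂ (fourierBasis k : L2) f = 0} := by
    ext f
    simp only [Set.mem_iInter, Set.mem_ofPred_eq, ← HilbertBasis.repr_apply_apply,
      fourierBasis_repr]
    rfl
  rw [h]
  exact isClosed_iInter fun k => isClosed_iInter fun _ =>
    isClosed_eq (by fun_prop) continuous_const

instance completeSpaceH2 : CompleteSpace H2 := isClosed_H2.completeSpace_coe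

/-- The Riesz projection `P`, which is the orthogonal projection of `L²` onto `H²`,
with values regarded as elements of `H²`. -/
def rieszProj : L2 →L[ℂ] H2 := H2.orthogonalProjectionOnto

/-- The Hankel operator `H(a) = P M(a) J P` restricted to `H²`, for a function `a` in `L^∞`. -/
def hankel (a : Circle → ℂ) (ha : EssBounded a) : H2 →L[ℂ] H2 :=
  rieszProj ∘L mulOp ha.toLInf ∘L flipOp ∘L H2.subtypeL

/-! ### The jump functions -/

/-- The function `u_{β,τ}(e^{iθ}) = exp (iβ(θ - θ₀ - π))`, where `0 < θ - θ₀ < 2π` and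
`τ = e^{iθ₀}`. Here `θ - θ₀ - π` is written as the argument of `-t/τ`. -/
def jump (β : ℂ) (τ t : Circle) : ℂ :=
  Complex.exp (Complex.I * β * (Complex.arg ((-(t / τ) : Circle) : ℂ) : ℝ))

theorem jump_exp (β : ℂ) (θ₀ θ : ℝ) (h₀ : 0 < θ - θ₀) (h₁ : θ - θ₀ < 2 * Real.pi) :
    jump β (Circle.exp θ₀) (Circle.exp θ) =
      Complex.exp (Complex.I * β * (θ - θ₀ - Real.pi : ℝ)) := by
  have h : -(Circle.exp θ / Circle.exp θ₀) = Circle.exp (θ - θ₀ - Real.pi) := by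
    rw [Circle.exp_sub, Circle.exp_sub]
    ext
    simp [div_neg]
  rw [jump, h, Circle.arg_exp (by linarith) (by linarith)]

theorem norm_mobius {r : ℝ} (hr : r ∈ Set.Ico (0 : ℝ) 1) (s : Circle) :
    ‖((s : ℂ) - r) / (1 - r * s)‖ = 1 := by
  have hne : (1 : ℂ) - r * s ≠ 0 := by
    intro h
    have h2 : ‖(r : ℂ) * s‖ = 1 := by
      rw [← sub_eq_zero.mp h, norm_one]
    rw [norm_mul, Circle.norm_coe, mul_one, Complex.norm_real, Real.norm_eq_abs,
      abs_of_nonneg hr.1] at h2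
    exact hr.2.ne h2
  have h3 : (s : ℂ) - r = s * (starRingEnd ℂ) (1 - r * s) := by
    have hs : (s : ℂ) * (starRingEnd ℂ) s = 1 := by
      rw [Complex.mul_conj, Circle.normSq_coe, Complex.ofReal_one]
    simp only [map_sub, map_one, map_mul, Complex.conj_ofReal]
    linear_combination (-(r : ℂ)) * (-hs)
  rw [norm_div, h3, norm_mul, Circle.norm_coe, one_mul, RCLike.norm_conj,
    div_self (norm_ne_zero_iff.mpr hne)]

/-- The map `t ↦ (t τ⁻¹ - r) / (1 - r t τ⁻¹)` of the unit circle to itself. -/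
def mobius (r : Set.Ico (0 : ℝ) 1) (τ t : Circle) : Circle :=
  ⟨(((t * τ⁻¹ : Circle) : ℂ) - (r : ℝ)) / (1 - (r : ℝ) * ((t * τ⁻¹ : Circle) : ℂ)),
    mem_sphere_zero_iff_norm.mpr (norm_mobius r.2 _)⟩

/-- The operator `G_{r,τ}⁻¹`. -/
def mobiusPullback (r : Set.Ico (0 : ℝ) 1) (τ : Circle) (a : Circle → ℂ) : Circle → ℂ :=
  fun t => a (mobius r τ t)

/-- `ψ_μ^{(1)} = G_{μ,1}⁻¹ (u_{-1/2,1} - 1)`. -/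
def psiPos (μ : Set.Ico (0 : ℝ) 1) : Circle → ℂ :=
  mobiusPullback μ 1 (jump (-1 / 2) 1 - 1)

/-- `ψ_μ^{(-1)} = G_{μ,-1}⁻¹ (u_{1/2,1} - 1)`. -/
def psiNeg (μ : Set.Ico (0 : ℝ) 1) : Circle → ℂ :=
  mobiusPullback μ (-1) (jump (1 / 2) 1 - 1)

theorem continuous_mobius (r : Set.Ico (0 : ℝ) 1) (τ : Circle) : Continuous (mobius r τ) := by
  refine Continuous.subtype_mk ?_ _
  refine Continuous.div (by fun_prop) (by fun_prop) fun t h => ?_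
  have h2 := norm_mobius r.2 (t * τ⁻¹)
  rw [h, div_zero, norm_zero] at h2
  exact zero_ne_one h2

theorem essBounded_mobiusPullback_jump (r : Set.Ico (0 : ℝ) 1) (τ τ' : Circle) (β : ℂ) :
    EssBounded (mobiusPullback r τ (jump β τ' - 1)) := by
  have hc : Continuous fun θ : Angles =>
      ((-(mobius r τ θ.toCircle / τ') : Circle) : ℂ) := by
    have h1 := (continuous_mobius r τ).comp (AddCircle.continuous_toCircle (T := 2 * Real.pi))
    have h2 : Continuous fun θ : Angles => mobius r τ θ.toCircle := h1
    exact continuous_subtype_val.comp (h2.div' continuous_const).neg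
  have hm : Measurable fun θ : Angles => mobiusPullback r τ (jump β τ' - 1) θ.toCircle := by
    have h := Complex.measurable_ofReal.comp (Complex.measurable_arg.comp hc.measurable)
    exact (Complex.measurable_exp.comp (h.const_mul (Complex.I * β))).sub_const 1
  refine MemLp.of_bound (p := ∞) hm.aestronglyMeasurable (Real.exp (‖β‖ * Real.pi) + 1)
    (Eventually.of_forall fun θ => ?_)
  refine (norm_sub_le _ _).trans (add_le_add ?_ (by simp))
  rw [jump, Complex.norm_exp, Real.exp_le_exp]
  refine (Complex.re_le_norm _).trans ?_
  rw [norm_mul, norm_mul, Complex.norm_I, one_mul, Complex.norm_real]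
  exact mul_le_mul_of_nonneg_left (Complex.abs_arg_le_pi _) (norm_nonneg _)

theorem essBounded_psiPos (μ : Set.Ico (0 : ℝ) 1) : EssBounded (psiPos μ) :=
  essBounded_mobiusPullback_jump _ _ _ _

theorem essBounded_psiNeg (μ : Set.Ico (0 : ℝ) 1) : EssBounded (psiNeg μ) :=
  essBounded_mobiusPullback_jump _ _ _ _

theorem EssBounded.mul {a b : Circle → ℂ} (ha : EssBounded a) (hb : EssBounded b) :
    EssBounded (a * b) :=
  MemLp.mul (r := ∞) (p := ∞) (q := ∞) hb ha

end

end JumpHankel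

open JumpHankel

/-!
A Hankel operator has matrix `(a_{j+k+1})`. For each of the symbols `ψ_μ^{(1)}`, `ψ_μ^{(-1)}` and
`ψ_μ^{(1)} ψ_μ^{(-1)}` these Fourier coefficients turn out to be the moments
`∫ p(x) x ^ (j + k) dx` of an explicit density `p` on `(-1, 1)`. Hence the operator is an integral
of rank one operators `p(x) k_x ⊗ k_x`, where `k_x = (1, x, x², …)` is the Szegő vector, of norm
`(1 - x²)^{-1/2}`, and everything reduces to integrals of the densities.

*The densities.* Let `R` be the principal square root of the Blaschke factor
`(μ - z) / (1 - μ z)`. It is holomorphic off the real axis, its cut inside the disc is `(μ, 1)`, and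
it has modulus one on the circle. On the upper half circle the values of `ψ_μ^{(1)}` at `t̄` and `t`
are `R(t) - 1` and its conjugate, and those of `ψ_μ^{(-1)}` are `R(-t)⁻¹ - 1` and its conjugate.
Cauchy's theorem for the upper half disc (`HasBoundaryValues.integral_arc`) moves the integral that
defines the coefficients to the segment `(-1, 1)`; only the imaginary part of the boundary values
survives, and so `p = -Im / π` (`HasBoundaryValues.fourierCoeff_eq`). With
`w(x) = ((x - μ) / (1 - μ x))^{1/2}` the density of `ψ_μ^{(1)}` is `w(x) / π` on `(μ, 1)`, and that
of `ψ_μ^{(-1)}` is `1 / (π w(-x))` on `(-1, -μ)`. The density of the product lives on both intervals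
and carries an additional factor which vanishes at `±1`.

*The trace norm.* By Bessel's inequality an integral `∫ x_ω ⊗ y_ω` of rank one operators has trace
norm at most `∫ ‖x_ω‖ ‖y_ω‖` (`isTraceClass_and_traceNorm_le_of_integral_rankOne`). For the product
symbol this gives `∫ |p(x)| / (1 - x²) dx`, which is `O(1 - μ)` (`HasMomentMatrix.traceClass`). A
product of the two Hankel operators is the integral of `q(y) (S k_y) ⊗ k_y`. The singularities at
`1` and `-1` do not interact, since `⟨k_x, k_y⟩ = 1 / (1 - x y) ≤ 1` when `x` and `y` have opposite
signs; so the trace norm is at most the product of the integrals of the two densities against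
`(1 - x²)^{-1/2}` (`HasMomentMatrix.comp_traceClass`). Each of them is `O((1 - μ)^{1/2})`.
-/

namespace JumpHankel

noncomputable section

/-! ### An upper bound for the trace norm -/

section TraceNorm

variable {H : Type*} [NormedAddCommGroup H] [InnerProductSpace ℂ H]

/-- `⟨A x, A y⟩ = ⟨|A| x, |A| y⟩`, the isometry behind the polar decomposition. -/
theorem inner_map_map_eq_inner_abs_abs [CompleteSpace H] (A : H →L[ℂ] H) (x y : H) :
    inner ℂ (A x) (A y) = inner ℂ ((CFC.abs A : H →L[ℂ] H) x) ((CFC.abs A : H →L[ℂ] H) y) := by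
  have hsa : IsSelfAdjoint (CFC.abs A : H →L[ℂ] H) := (CFC.abs_nonneg A).isSelfAdjoint
  have h : (CFC.abs A : H →L[ℂ] H) ((CFC.abs A : H →L[ℂ] H) y)
      = ContinuousLinearMap.adjoint A (A y) := by
    have h2 := CFC.abs_mul_abs A
    exact congrArg (fun T : H →L[ℂ] H => T y) h2
  rw [← ContinuousLinearMap.adjoint_inner_right A, ← h,
    ← ContinuousLinearMap.adjoint_inner_right (CFC.abs A : H →L[ℂ] H),
    hsa.adjoint_eq]

/-- If `e` is an orthonormal family of eigenvectors of `|A|` with positive eigenvalues `s`, then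
the vectors `s⁻¹ A e` are orthonormal too, and they pair with `A e` to give `s`. So any bound on
`∑ |⟨f i, A e i⟩|` that is uniform over orthonormal families bounds the sum of the `s`. -/
theorem sum_singularValue_le [CompleteSpace H] {A : H →L[ℂ] H} {C : ℝ}
    (hC : ∀ (ι : Type) [Fintype ι] (e f : ι → H), Orthonormal ℂ e → Orthonormal ℂ f →
      ∑ i, ‖inner ℂ (f i) (A (e i))‖ ≤ C)
    {ι : Type} [Fintype ι] {e : ι → H} (he : Orthonormal ℂ e) {s : ι → ℝ} (hs : ∀ i, 0 < s i)
    (hes : ∀ i, (CFC.abs A : H →L[ℂ] H) (e i) = (s i : ℂ) • e i) :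
    ∑ i, s i ≤ C := by
  classical
  have hAA : ∀ i j, inner ℂ (A (e i)) (A (e j)) = if i = j then (s i : ℂ) ^ 2 else 0 := by
    intro i j
    rw [inner_map_map_eq_inner_abs_abs, hes, hes, inner_smul_left, inner_smul_right,
      orthonormal_iff_ite.mp he i j]
    split_ifs with h
    · subst h
      simp [sq]
    · simp
  have hf : Orthonormal ℂ fun i => ((s i : ℂ)⁻¹) • A (e i) := by
    rw [orthonormal_iff_ite]
    intro i j
    rw [inner_smul_left, inner_smul_right, hAA]
    split_ifs with h
    · subst h
      have : (s i : ℂ) ≠ 0 := by exact_mod_cast (hs i).ne'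
      simp
      field_simp
    · simp
  refine le_trans (le_of_eq ?_) (hC ι e _ he hf)
  refine Finset.sum_congr rfl fun i _ => ?_
  have : (s i : ℂ) ≠ 0 := by exact_mod_cast (hs i).ne'
  rw [inner_smul_left, hAA, if_pos rfl]
  simp only [map_inv₀, Complex.conj_ofReal]
  rw [sq, inv_mul_cancel_left₀ this, Complex.norm_real, Real.norm_eq_abs, abs_of_pos (hs i)]

theorem exists_orthonormal_of_le_toENat_rank {E : Submodule ℂ H} {m : ℕ}
    (hm : (m : ℕ∞) ≤ Cardinal.toENat (Module.rank ℂ E)) :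
    ∃ v : Fin m → E, Orthonormal ℂ v := by
  have h1 : (m : Cardinal) ≤ Module.rank ℂ E := by
    rwa [← Cardinal.toENat_nat, Cardinal.toENat_le_iff_of_le_aleph0
      (Cardinal.natCast_lt_aleph0).le] at hm
  obtain ⟨w, hw⟩ := Module.le_rank_iff.mp h1
  exact ⟨_, InnerProductSpace.gramSchmidtNormed_orthonormal hw⟩

theorem sum_mul_le_of_le_singularMultiplicity [CompleteSpace H] {A : H →L[ℂ] H} {C : ℝ}
    (hC : ∀ (ι : Type) [Fintype ι] (e f : ι → H), Orthonormal ℂ e → Orthonormal ℂ f →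
      ∑ i, ‖inner ℂ (f i) (A (e i))‖ ≤ C)
    (S : Finset (Set.Ioi (0 : ℝ))) (m : Set.Ioi (0 : ℝ) → ℕ)
    (hm : ∀ s ∈ S, (m s : ℕ∞) ≤ singularMultiplicity A s) :
    ∑ s ∈ S, (m s : ℝ) * s ≤ C := by
  choose! v hv using fun (s : Set.Ioi (0 : ℝ)) (hs : s ∈ S) =>
    exists_orthonormal_of_le_toENat_rank (hm s hs)
  have hsa : IsSelfAdjoint (CFC.abs A : H →L[ℂ] H) := (CFC.abs_nonneg A).isSelfAdjoint
  have hsym := hsa.isSymmetric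
  have hinj : Function.Injective fun s : S => ((s : Set.Ioi (0 : ℝ)) : ℂ) := by
    intro s t h
    exact Subtype.ext (Subtype.ext (Complex.ofReal_injective h))
  have hof := hsym.orthogonalFamily_eigenspaces.comp hinj
  have hon := hof.orthonormal_sigma_orthonormal (v_family := fun s : S => v s)
    (fun s => hv s s.2)
  have h := sum_singularValue_le hC hon (s := fun i => ((i.1 : Set.Ioi (0 : ℝ)) : ℝ))
    (fun i => i.1.1.2) (fun i => Module.End.mem_eigenspace_iff.mp (v i.1 i.2).2)
  rw [Fintype.sum_sigma] at h
  rw [← Finset.sum_coe_sort S (fun s => (m s : ℝ) * (s : ℝ))]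
  simpa using h

/-- The variational bound for the trace norm. The uniform bound forces all multiplicities of
positive singular values to be finite, so that eigenbases of finitely many of them can be combined
into one finite orthonormal family. -/
theorem traceNorm_le [CompleteSpace H] {A : H →L[ℂ] H} {C : ℝ}
    (hC : ∀ (ι : Type) [Fintype ι] (e f : ι → H), Orthonormal ℂ e → Orthonormal ℂ f →
      ∑ i, ‖inner ℂ (f i) (A (e i))‖ ≤ C) :
    traceNorm A ≤ ENNReal.ofReal C := by
  have hfin : ∀ s : Set.Ioi (0 : ℝ), singularMultiplicity A s ≠ ⊤ := by
    intro s hs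
    obtain ⟨m, hm⟩ := exists_nat_gt (C / s)
    have h := sum_mul_le_of_le_singularMultiplicity hC {s} (fun _ => m) (by simp [hs])
    rw [Finset.sum_singleton] at h
    rw [div_lt_iff₀ s.2] at hm
    linarith
  rw [traceNorm, ENNReal.tsum_eq_iSup_sum]
  refine iSup_le fun S => ?_
  have h := sum_mul_le_of_le_singularMultiplicity hC S
    (fun s => (singularMultiplicity A s).toNat) (fun s _ => by simp [ENat.natCast_toNat (hfin s)])
  refine le_trans (le_of_eq ?_) (ENNReal.ofReal_le_ofReal h)
  rw [ENNReal.ofReal_sum_of_nonneg fun s _ => mul_nonneg (Nat.cast_nonneg _) (le_of_lt s.2)]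
  refine Finset.sum_congr rfl fun s _ => ?_
  rw [ENNReal.ofReal_mul (Nat.cast_nonneg _), ENNReal.ofReal_natCast]
  congr 1
  conv_lhs => rw [← ENat.natCast_toNat (hfin s)]
  rfl

end TraceNorm

/-! ### Integrals of rank one operators -/

section RankOne

variable {H : Type*} [NormedAddCommGroup H] [InnerProductSpace ℂ H]
  {Ω : Type*} [MeasurableSpace Ω] {ν : Measure Ω}

/-- The integral of a function with values in a closed subspace lies in it: its image in the
quotient space vanishes. -/
theorem integral_mem_of_isClosed {E : Type*} [NormedAddCommGroup E] [NormedSpace ℂ E]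
    [CompleteSpace E] {K : Submodule ℂ E} (hK : IsClosed (K : Set E)) {f : Ω → E}
    (hf : Integrable f ν) (hfK : ∀ ω, f ω ∈ K) : ∫ ω, f ω ∂ν ∈ K := by
  have := hK
  rw [← Submodule.Quotient.mk_eq_zero]
  have h := K.mkQL.integral_comp_comm hf
  refine h.symm.trans ?_
  have h0 : ∀ ω, K.mkQL (f ω) = 0 := fun ω => (Submodule.Quotient.mk_eq_zero K).mpr (hfK ω)
  simp [h0]

theorem integrable_rankOne {x y : Ω → H} (hx : AEStronglyMeasurable x ν)
    (hy : AEStronglyMeasurable y ν) (hxy : Integrable (fun ω => ‖x ω‖ * ‖y ω‖) ν) :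
    Integrable (fun ω => InnerProductSpace.rankOne ℂ (x ω) (y ω)) ν := by
  refine hxy.mono' ?_ (Eventually.of_forall fun ω => by simp)
  have hc : Continuous fun z : H × H => (innerSL ℂ z.2).smulRight z.1 :=
    (ContinuousLinearMap.smulRightL ℂ H H).continuous₂.comp
      (((innerSL ℂ).continuous.comp continuous_snd).prodMk continuous_fst)
  exact hc.comp_aestronglyMeasurable (hx.prodMk hy)

theorem isCompactOperator_rankOne (x y : H) :
    IsCompactOperator (InnerProductSpace.rankOne ℂ x y) := by
  rw [InnerProductSpace.rankOne_def']
  exact (isCompactOperator_of_locallyCompactSpace_rng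
    (ContinuousLinearMap.toSpanSingleton ℂ x)).comp_clm (innerSL ℂ y)

/-- Cauchy–Schwarz together with Bessel's inequality. -/
theorem sum_norm_inner_mul_inner_le {ι : Type*} [Fintype ι] {e f : ι → H} (he : Orthonormal ℂ e)
    (hf : Orthonormal ℂ f) (x y : H) :
    ∑ i, ‖inner ℂ (f i) x‖ * ‖inner ℂ y (e i)‖ ≤ ‖x‖ * ‖y‖ := by
  refine (Real.sum_mul_le_sqrt_mul_sqrt _ _ _).trans ?_
  refine mul_le_mul ?_ ?_ (Real.sqrt_nonneg _) (norm_nonneg _)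
  · exact Real.sqrt_le_left (norm_nonneg _) |>.mpr (hf.sum_inner_products_le x)
  · refine Real.sqrt_le_left (norm_nonneg _) |>.mpr ?_
    simp_rw [norm_inner_symm y]
    exact he.sum_inner_products_le y

/-- An absolutely convergent integral of rank one operators is a trace class operator. -/
theorem isTraceClass_and_traceNorm_le_of_integral_rankOne [CompleteSpace H] {x y : Ω → H}
    (hx : AEStronglyMeasurable x ν) (hy : AEStronglyMeasurable y ν)
    (hxy : Integrable (fun ω => ‖x ω‖ * ‖y ω‖) ν) {A : H →L[ℂ] H}
    (hA : A = ∫ ω, InnerProductSpace.rankOne ℂ (x ω) (y ω) ∂ν) :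
    IsTraceClass A ∧ traceNorm A ≤ ENNReal.ofReal (∫ ω, ‖x ω‖ * ‖y ω‖ ∂ν) := by
  have hint := integrable_rankOne hx hy hxy
  have htn : traceNorm A ≤ ENNReal.ofReal (∫ ω, ‖x ω‖ * ‖y ω‖ ∂ν) := by
    refine traceNorm_le fun ι _ e f he hf => ?_
    have hnorm : ∀ i, ‖inner ℂ (f i) (A (e i))‖
        ≤ ∫ ω, ‖inner ℂ (f i) (x ω)‖ * ‖inner ℂ (y ω) (e i)‖ ∂ν := by
      intro i
      have h1 : inner ℂ (f i) (A (e i))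
          = ∫ ω, inner ℂ (f i) (x ω) * inner ℂ (y ω) (e i) ∂ν := by
        rw [hA, ContinuousLinearMap.integral_apply hint, ← integral_inner
          (hint.apply_continuousLinearMap (e i))]
        refine integral_congr_ae (Eventually.of_forall fun ω => ?_)
        simp [inner_smul_right, mul_comm]
      rw [h1]
      refine (norm_integral_le_integral_norm _).trans (le_of_eq ?_)
      simp
    have hi : ∀ i, Integrable (fun ω => ‖inner ℂ (f i) (x ω)‖ * ‖inner ℂ (y ω) (e i)‖) ν := by
      intro i
      refine hxy.mono' ?_ (Eventually.of_forall fun ω => ?_)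
      · exact (aestronglyMeasurable_const.inner hx).norm.mul
          (hy.inner aestronglyMeasurable_const).norm
      · rw [norm_mul, norm_norm, norm_norm]
        refine mul_le_mul ?_ ?_ (norm_nonneg _) (norm_nonneg _)
        · simpa [hf.1 i] using norm_inner_le_norm (𝕜 := ℂ) (f i) (x ω)
        · simpa [he.1 i] using norm_inner_le_norm (𝕜 := ℂ) (y ω) (e i)
    refine (Finset.sum_le_sum fun i _ => hnorm i).trans ?_
    rw [← integral_finsetSum _ fun i _ => hi i]
    exact integral_mono (integrable_finsetSum _ fun i _ => hi i) hxy
      fun ω => sum_norm_inner_mul_inner_le he hf _ _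
  refine ⟨⟨?_, htn.trans_lt ENNReal.ofReal_lt_top⟩, htn⟩
  have := integral_mem_of_isClosed (K := compactOperator (RingHom.id ℂ) H H)
    isClosed_setOfPred_isCompactOperator hint fun ω => isCompactOperator_rankOne _ _
  rw [hA]
  exact this

end RankOne

/-! ### Operators with a moment matrix -/

section Moment

variable {H : Type*} [NormedAddCommGroup H] [InnerProductSpace ℂ H]

/-- The vector with coordinates `1, x, x², …` in the Hilbert basis `b`, for `|x| < 1`. In `H²` it is
the Szegő kernel at the real point `x`. -/
def szegoVec (b : HilbertBasis ℕ ℂ H) (x : ℝ) : H := ∑' j, ((x : ℂ) ^ j) • b j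

/-- The operator `T` has the Hankel matrix whose entries are the moments of the density `p`
on `(-1, 1)`. -/
def HasMomentMatrix (b : HilbertBasis ℕ ℂ H) (T : H →L[ℂ] H) (p : ℝ → ℝ) : Prop :=
  ∀ j k : ℕ, inner ℂ (b j) (T (b k)) = ∫ x in Set.Ioo (-1 : ℝ) 1, (p x : ℂ) * (x : ℂ) ^ (j + k)

variable (b : HilbertBasis ℕ ℂ H)

theorem norm_ofReal_lt_one {x : ℝ} (hx : x ∈ Set.Ioo (-1 : ℝ) 1) : ‖(x : ℂ)‖ < 1 := by
  rw [Complex.norm_real, Real.norm_eq_abs]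
  exact abs_lt.mpr hx

theorem hasSum_szegoVec [CompleteSpace H] {x : ℝ} (hx : x ∈ Set.Ioo (-1 : ℝ) 1) :
    HasSum (fun j => ((x : ℂ) ^ j) • b j) (szegoVec b x) := by
  refine Summable.hasSum (Summable.of_norm ?_)
  simp_rw [norm_smul, b.orthonormal.1, mul_one, norm_pow]
  exact summable_geometric_of_lt_one (norm_nonneg _) (norm_ofReal_lt_one hx)

theorem inner_basis_szegoVec [CompleteSpace H] {x : ℝ} (hx : x ∈ Set.Ioo (-1 : ℝ) 1) (j : ℕ) :
    inner ℂ (b j) (szegoVec b x) = (x : ℂ) ^ j := by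
  classical
  have h := (hasSum_szegoVec b hx).mapL (innerSL ℂ (b j))
  have h2 : ∀ k, innerSL ℂ (b j) ((x : ℂ) ^ k • b k) = if k = j then (x : ℂ) ^ j else 0 := by
    intro k
    rw [innerSL_apply_apply, inner_smul_right, orthonormal_iff_ite.mp b.orthonormal j k]
    by_cases h : j = k
    · simp [h]
    · simp [h, Ne.symm h]
  simp_rw [h2] at h
  exact h.unique (hasSum_ite_eq j ((x : ℂ) ^ j))

theorem inner_szegoVec_basis [CompleteSpace H] {x : ℝ} (hx : x ∈ Set.Ioo (-1 : ℝ) 1) (j : ℕ) :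
    inner ℂ (szegoVec b x) (b j) = (x : ℂ) ^ j := by
  rw [← inner_conj_symm, inner_basis_szegoVec b hx, map_pow, Complex.conj_ofReal]

theorem one_sub_sq_pos {x : ℝ} (hx : x ∈ Set.Ioo (-1 : ℝ) 1) : 0 < 1 - x ^ 2 := by
  nlinarith [hx.1, hx.2]

theorem norm_szegoVec_sq [CompleteSpace H] {x : ℝ} (hx : x ∈ Set.Ioo (-1 : ℝ) 1) :
    ‖szegoVec b x‖ ^ 2 = (1 - x ^ 2)⁻¹ := by
  have h := (hasSum_szegoVec b hx).mapL (innerSL ℂ (szegoVec b x))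
  simp only [innerSL_apply_apply, inner_smul_right, inner_szegoVec_basis b hx,
    inner_self_eq_norm_sq_to_K, ← pow_add, ← two_mul, pow_mul] at h
  have hlt : ‖(x : ℂ) ^ 2‖ < 1 := by
    rw [norm_pow]
    exact pow_lt_one₀ (norm_nonneg _) (norm_ofReal_lt_one hx) two_ne_zero
  have h3 := h.unique (hasSum_geometric_of_norm_lt_one hlt)
  refine Complex.ofReal_injective ?_
  push_cast
  exact h3

theorem norm_szegoVec [CompleteSpace H] {x : ℝ} (hx : x ∈ Set.Ioo (-1 : ℝ) 1) :
    ‖szegoVec b x‖ = (√(1 - x ^ 2))⁻¹ := by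
  rw [← Real.sqrt_inv, ← norm_szegoVec_sq b hx, Real.sqrt_sq (norm_nonneg _)]

theorem aestronglyMeasurable_szegoVec [CompleteSpace H] :
    AEStronglyMeasurable (szegoVec b) (volume.restrict (Set.Ioo (-1 : ℝ) 1)) := by
  refine aestronglyMeasurable_of_tendsto_ae atTop
    (f := fun n (x : ℝ) => ∑ j ∈ Finset.range n, ((x : ℂ) ^ j) • b j) (fun n => ?_) ?_
  · refine Continuous.aestronglyMeasurable ?_
    fun_prop
  · refine (ae_restrict_iff' measurableSet_Ioo).mpr (Eventually.of_forall fun x hx => ?_)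
    exact (hasSum_szegoVec b hx).tendsto_sum_nat

theorem clm_ext_basis {E : Type*} [NormedAddCommGroup E] [NormedSpace ℂ E] {S T : H →L[ℂ] E}
    (h : ∀ k, S (b k) = T (b k)) : S = T := by
  refine ContinuousLinearMap.ext_on
    (Submodule.dense_iff_topologicalClosure_eq_top.mpr b.dense_span) ?_
  rintro _ ⟨k, rfl⟩
  exact h k

theorem ext_inner_basis {u v : H} (h : ∀ j, inner ℂ (b j) u = inner ℂ (b j) v) : u = v := by
  refine b.repr.injective (lp.ext (funext fun j => ?_))
  rw [b.repr_apply_apply, b.repr_apply_apply, h]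

variable {b} {p q : ℝ → ℝ} {S T : H →L[ℂ] H}

theorem integrable_smul_szegoVec [CompleteSpace H] (hp : Measurable p)
    (hpi : IntegrableOn (fun x => |p x| * (√(1 - x ^ 2))⁻¹) (Set.Ioo (-1 : ℝ) 1)) {c : ℝ → ℂ}
    (hc : Measurable c) (C : ℝ) (hcC : ∀ x ∈ Set.Ioo (-1 : ℝ) 1, p x ≠ 0 → ‖c x‖ ≤ C) :
    IntegrableOn (fun x => ((p x : ℂ) * c x) • szegoVec b x) (Set.Ioo (-1 : ℝ) 1) := by
  refine (hpi.const_mul C).mono' ?_ ?_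
  · exact ((Complex.measurable_ofReal.comp hp).mul hc).aestronglyMeasurable.smul
      (aestronglyMeasurable_szegoVec b)
  · refine (ae_restrict_iff' measurableSet_Ioo).mpr (Eventually.of_forall fun x hx => ?_)
    rw [norm_smul, norm_mul, norm_szegoVec b hx, Complex.norm_real, Real.norm_eq_abs, ← mul_assoc]
    refine mul_le_mul_of_nonneg_right ?_ (by positivity)
    by_cases h0 : p x = 0
    · simp [h0]
    · rw [mul_comm]
      exact mul_le_mul_of_nonneg_right (hcC x hx h0) (abs_nonneg _)

theorem norm_pow_le_one {x : ℝ} (hx : x ∈ Set.Ioo (-1 : ℝ) 1) (k : ℕ) : ‖(x : ℂ) ^ k‖ ≤ 1 := by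
  rw [norm_pow]
  exact pow_le_one₀ (norm_nonneg _) (norm_ofReal_lt_one hx).le

theorem HasMomentMatrix.apply_basis [CompleteSpace H] (hT : HasMomentMatrix b T p)
    (hp : Measurable p)
    (hpi : IntegrableOn (fun x => |p x| * (√(1 - x ^ 2))⁻¹) (Set.Ioo (-1 : ℝ) 1)) (k : ℕ) :
    T (b k) = ∫ x in Set.Ioo (-1 : ℝ) 1, ((p x : ℂ) * (x : ℂ) ^ k) • szegoVec b x := by
  have hi := integrable_smul_szegoVec (b := b) hp hpi (c := fun x => (x : ℂ) ^ k)
    (by fun_prop) 1 (fun x hx _ => norm_pow_le_one hx k)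
  refine ext_inner_basis b fun j => ?_
  rw [hT, ← integral_inner hi]
  refine setIntegral_congr_fun measurableSet_Ioo fun x hx => ?_
  simp only [inner_smul_right, inner_basis_szegoVec b hx]
  ring

/-- The expansion `k_y = ∑ y ^ k b_k` and the geometric series turn the kernel into
`⟨k_x, k_y⟩ = (1 - x y)⁻¹`. -/
theorem HasMomentMatrix.apply_szegoVec [CompleteSpace H] (hT : HasMomentMatrix b T p)
    (hp : Measurable p)
    (hpi : IntegrableOn (fun x => |p x| * (√(1 - x ^ 2))⁻¹) (Set.Ioo (-1 : ℝ) 1)) {y : ℝ}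
    (hy : y ∈ Set.Ioo (-1 : ℝ) 1) :
    T (szegoVec b y) =
      ∫ x in Set.Ioo (-1 : ℝ) 1, ((p x : ℂ) * (1 - (y : ℂ) * x)⁻¹) • szegoVec b x := by
  have h1 := (hasSum_szegoVec b hy).mapL T
  have hi : ∀ k : ℕ, IntegrableOn
      (fun x : ℝ => ((p x : ℂ) * ((y : ℂ) ^ k * (x : ℂ) ^ k)) • szegoVec b x)
      (Set.Ioo (-1 : ℝ) 1) := by
    intro k
    refine integrable_smul_szegoVec hp hpi (c := fun x => (y : ℂ) ^ k * (x : ℂ) ^ k)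
      (by fun_prop) 1 fun x hx _ => ?_
    rw [norm_mul]
    exact mul_le_one₀ (norm_pow_le_one hy k) (norm_nonneg _) (norm_pow_le_one hx k)
  have h2 : Summable fun k : ℕ => ∫ x in Set.Ioo (-1 : ℝ) 1,
      ‖((p x : ℂ) * ((y : ℂ) ^ k * (x : ℂ) ^ k)) • szegoVec b x‖ := by
    refine Summable.of_nonneg_of_le (fun k => integral_nonneg fun x => norm_nonneg _)
      (fun k => ?_)
      ((summable_geometric_of_lt_one (norm_nonneg _) (norm_ofReal_lt_one hy)).mul_right
        (∫ x in Set.Ioo (-1 : ℝ) 1, |p x| * (√(1 - x ^ 2))⁻¹))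
    rw [← integral_const_mul]
    refine setIntegral_mono_on (hi k).norm (hpi.const_mul _) measurableSet_Ioo fun x hx => ?_
    rw [norm_smul, norm_mul, norm_mul, norm_szegoVec b hx, Complex.norm_real (p x),
      Real.norm_eq_abs, norm_pow (y : ℂ)]
    have h0 := mul_le_of_le_one_right (pow_nonneg (norm_nonneg (y : ℂ)) k) (norm_pow_le_one hx k)
    calc |p x| * (‖(y : ℂ)‖ ^ k * ‖(x : ℂ) ^ k‖) * (√(1 - x ^ 2))⁻¹
        ≤ |p x| * ‖(y : ℂ)‖ ^ k * (√(1 - x ^ 2))⁻¹ := by gcongr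
      _ = ‖(y : ℂ)‖ ^ k * (|p x| * (√(1 - x ^ 2))⁻¹) := by ring
  have h3 := hasSum_integral_of_summable_integral_norm hi h2
  have h4 : ∀ k : ℕ, T ((y : ℂ) ^ k • b k) = ∫ x in Set.Ioo (-1 : ℝ) 1,
      ((p x : ℂ) * ((y : ℂ) ^ k * (x : ℂ) ^ k)) • szegoVec b x := by
    intro k
    rw [map_smul, hT.apply_basis hp hpi, ← integral_smul]
    refine integral_congr_ae (Eventually.of_forall fun x => ?_)
    simp only [smul_smul]
    congr 1
    ring
  simp_rw [h4] at h1
  rw [h1.unique h3]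
  refine setIntegral_congr_fun measurableSet_Ioo fun x hx => ?_
  have hlt : ‖(y : ℂ) * x‖ < 1 := by
    rw [norm_mul]
    exact mul_lt_one_of_nonneg_of_lt_one_left (norm_nonneg _) (norm_ofReal_lt_one hy)
      (norm_ofReal_lt_one hx).le
  have h5 := ((hasSum_geometric_of_norm_lt_one hlt).mul_left (p x : ℂ)).smul_const (szegoVec b x)
  simp only [mul_pow] at h5
  exact h5.tsum_eq

/-- `1 - x y ≥ 1` when `x` and `y` have opposite signs, which is why the Szegő vectors at points of
opposite sign do not see each other's singularity. -/
theorem HasMomentMatrix.norm_apply_szegoVec_le [CompleteSpace H] (hT : HasMomentMatrix b T p)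
    (hp : Measurable p)
    (hpi : IntegrableOn (fun x => |p x| * (√(1 - x ^ 2))⁻¹) (Set.Ioo (-1 : ℝ) 1)) {y : ℝ}
    (hy : y ∈ Set.Ioo (-1 : ℝ) 1) (hpy : ∀ x, p x ≠ 0 → x * y ≤ 0) :
    ‖T (szegoVec b y)‖ ≤ ∫ x in Set.Ioo (-1 : ℝ) 1, |p x| * (√(1 - x ^ 2))⁻¹ := by
  rw [hT.apply_szegoVec hp hpi hy]
  refine norm_integral_le_of_norm_le hpi ?_
  refine (ae_restrict_iff' measurableSet_Ioo).mpr (Eventually.of_forall fun x hx => ?_)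
  rw [norm_smul, norm_mul, norm_szegoVec b hx, Complex.norm_real, Real.norm_eq_abs]
  refine mul_le_mul_of_nonneg_right ?_ (by positivity)
  by_cases h0 : p x = 0
  · simp [h0]
  · refine mul_le_of_le_one_right (abs_nonneg _) ?_
    rw [norm_inv]
    refine inv_le_one_of_one_le₀ ?_
    have h1 : (1 : ℂ) - y * x = ((1 - y * x : ℝ) : ℂ) := by push_cast; ring
    rw [h1, Complex.norm_real, Real.norm_eq_abs]
    refine le_trans ?_ (le_abs_self _)
    linarith [hpy x h0]

/-- If the densities of `S` and `T` sit on opposite sides of the origin, then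
`S T = ∫ q(y) (S k_y) ⊗ k_y dy` converges absolutely, where `k_y` is the Szegő vector. -/
theorem HasMomentMatrix.comp_traceClass [CompleteSpace H] (hS : HasMomentMatrix b S p)
    (hT : HasMomentMatrix b T q) (hp : Measurable p) (hq : Measurable q)
    (hpi : IntegrableOn (fun x => |p x| * (√(1 - x ^ 2))⁻¹) (Set.Ioo (-1 : ℝ) 1))
    (hqi : IntegrableOn (fun x => |q x| * (√(1 - x ^ 2))⁻¹) (Set.Ioo (-1 : ℝ) 1))
    (hpq : ∀ x y, p x ≠ 0 → q y ≠ 0 → x * y ≤ 0) :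
    IsTraceClass (S ∘L T) ∧ traceNorm (S ∘L T) ≤ ENNReal.ofReal
      ((∫ x in Set.Ioo (-1 : ℝ) 1, |p x| * (√(1 - x ^ 2))⁻¹) *
        ∫ x in Set.Ioo (-1 : ℝ) 1, |q x| * (√(1 - x ^ 2))⁻¹) := by
  set M := ∫ x in Set.Ioo (-1 : ℝ) 1, |p x| * (√(1 - x ^ 2))⁻¹
  have hk := aestronglyMeasurable_szegoVec b
  have hx : AEStronglyMeasurable (fun y => (q y : ℂ) • S (szegoVec b y))
      (volume.restrict (Set.Ioo (-1 : ℝ) 1)) :=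
    (Complex.measurable_ofReal.comp hq).aestronglyMeasurable.smul
      (S.continuous.comp_aestronglyMeasurable hk)
  have hbd : ∀ y ∈ Set.Ioo (-1 : ℝ) 1, ‖(q y : ℂ) • S (szegoVec b y)‖ * ‖szegoVec b y‖
      ≤ M * (|q y| * (√(1 - y ^ 2))⁻¹) := by
    intro y hy
    rw [norm_smul, norm_szegoVec b hy, Complex.norm_real, Real.norm_eq_abs, ← mul_assoc]
    refine mul_le_mul_of_nonneg_right ?_ (by positivity)
    by_cases h0 : q y = 0
    · simp [h0]
    · rw [mul_comm]
      exact mul_le_mul_of_nonneg_right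
        (hS.norm_apply_szegoVec_le hp hpi hy fun x hx => hpq x y hx h0) (abs_nonneg _)
  have hxy : IntegrableOn (fun y => ‖(q y : ℂ) • S (szegoVec b y)‖ * ‖szegoVec b y‖)
      (Set.Ioo (-1 : ℝ) 1) := by
    refine (hqi.const_mul M).mono' (hx.norm.mul hk.norm) ?_
    refine (ae_restrict_iff' measurableSet_Ioo).mpr (Eventually.of_forall fun y hy => ?_)
    rw [Real.norm_eq_abs, abs_of_nonneg (by positivity)]
    exact hbd y hy
  have hA : S ∘L T = ∫ y in Set.Ioo (-1 : ℝ) 1,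
      InnerProductSpace.rankOne ℂ ((q y : ℂ) • S (szegoVec b y)) (szegoVec b y) := by
    refine clm_ext_basis b fun k => ?_
    rw [ContinuousLinearMap.integral_apply (integrable_rankOne hx hk hxy),
      ContinuousLinearMap.comp_apply, hT.apply_basis hq hqi,
      ← S.integral_comp_comm (integrable_smul_szegoVec hq hqi (c := fun x => (x : ℂ) ^ k)
        (by fun_prop) 1 (fun x hx _ => norm_pow_le_one hx k))]
    refine setIntegral_congr_fun measurableSet_Ioo fun y hy => ?_
    rw [map_smul, InnerProductSpace.rankOne_apply, inner_szegoVec_basis b hy, smul_smul, mul_comm]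
  obtain ⟨h1, h2⟩ := isTraceClass_and_traceNorm_le_of_integral_rankOne hx hk hxy hA
  refine ⟨h1, h2.trans (ENNReal.ofReal_le_ofReal ?_)⟩
  rw [← integral_const_mul]
  exact setIntegral_mono_on hxy (hqi.const_mul M) measurableSet_Ioo hbd

/-- A single operator `T = ∫ p(x) k_x ⊗ k_x dx` is trace class under the stronger condition that `p`
is integrable against `‖k_x‖² = (1 - x²)⁻¹`. -/
theorem HasMomentMatrix.traceClass [CompleteSpace H] (hT : HasMomentMatrix b T p)
    (hp : Measurable p)
    (hpi : IntegrableOn (fun x => |p x| * (1 - x ^ 2)⁻¹) (Set.Ioo (-1 : ℝ) 1)) :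
    IsTraceClass T ∧ traceNorm T ≤ ENNReal.ofReal
      (∫ x in Set.Ioo (-1 : ℝ) 1, |p x| * (1 - x ^ 2)⁻¹) := by
  have hk := aestronglyMeasurable_szegoVec b
  have hpi' : IntegrableOn (fun x => |p x| * (√(1 - x ^ 2))⁻¹) (Set.Ioo (-1 : ℝ) 1) := by
    refine hpi.mono' ?_ ?_
    · exact (by fun_prop : Measurable fun x => |p x| * (√(1 - x ^ 2))⁻¹).aestronglyMeasurable
    refine (ae_restrict_iff' measurableSet_Ioo).mpr (Eventually.of_forall fun x hx => ?_)
    rw [Real.norm_eq_abs, abs_of_nonneg (by positivity)]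
    refine mul_le_mul_of_nonneg_left ?_ (abs_nonneg _)
    have h0 := one_sub_sq_pos hx
    refine inv_anti₀ h0 ?_
    refine Real.le_sqrt_of_sq_le ?_
    nlinarith [sq_nonneg x]
  have hx : AEStronglyMeasurable (fun y => (p y : ℂ) • szegoVec b y)
      (volume.restrict (Set.Ioo (-1 : ℝ) 1)) :=
    (Complex.measurable_ofReal.comp hp).aestronglyMeasurable.smul hk
  have hbd : Set.EqOn (fun y => |p y| * (1 - y ^ 2)⁻¹)
      (fun y => ‖(p y : ℂ) • szegoVec b y‖ * ‖szegoVec b y‖) (Set.Ioo (-1 : ℝ) 1) := by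
    intro y hy
    simp only
    rw [norm_smul, mul_assoc, ← sq, norm_szegoVec_sq b hy, Complex.norm_real, Real.norm_eq_abs]
  have hxy := hpi.congr_fun hbd measurableSet_Ioo
  have hA : T = ∫ y in Set.Ioo (-1 : ℝ) 1,
      InnerProductSpace.rankOne ℂ ((p y : ℂ) • szegoVec b y) (szegoVec b y) := by
    refine clm_ext_basis b fun k => ?_
    rw [ContinuousLinearMap.integral_apply (integrable_rankOne hx hk hxy),
      hT.apply_basis hp hpi']
    refine setIntegral_congr_fun measurableSet_Ioo fun y hy => ?_
    simp only [InnerProductSpace.rankOne_apply, inner_szegoVec_basis b hy, smul_smul]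
    congr 1
    ring
  obtain ⟨h1, h2⟩ := isTraceClass_and_traceNorm_le_of_integral_rankOne hx hk hxy hA
  refine ⟨h1, h2.trans (ENNReal.ofReal_le_ofReal (le_of_eq ?_))⟩
  exact (setIntegral_congr_fun measurableSet_Ioo hbd).symm

end Moment

/-! ### The Hardy space and the matrix of a Hankel operator -/

section Hardy

theorem orthonormal_fourierLp_nat :
    Orthonormal ℂ fun j : ℕ => (fourierLp 2 (j : ℤ) : L2) :=
  orthonormal_fourier.comp _ Nat.cast_injective

theorem fourierLp_mem_H2 (j : ℕ) : (fourierLp 2 (j : ℤ) : L2) ∈ H2 := by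
  intro k hk
  rw [← fourierBasis_repr, HilbertBasis.repr_apply_apply, coe_fourierBasis]
  exact orthonormal_fourier.2 (by omega)

/-- The monomial `t ^ j` as an element of `H²`. -/
def hardyMonomial (j : ℕ) : H2 := ⟨fourierLp 2 (j : ℤ), fourierLp_mem_H2 j⟩

theorem orthonormal_hardyMonomial : Orthonormal ℂ hardyMonomial :=
  ⟨fun j => orthonormal_fourierLp_nat.1 j, fun _ _ hij => orthonormal_fourierLp_nat.2 hij⟩

theorem orthogonal_span_hardyMonomial :
    (Submodule.span ℂ (Set.range hardyMonomial))ᗮ = ⊥ := by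
  rw [Submodule.eq_bot_iff]
  intro f hf
  rw [Submodule.mem_orthogonal] at hf
  refine Subtype.ext (fourierBasis.repr.injective (lp.ext (funext fun k => ?_)))
  rw [fourierBasis_repr]
  simp only [Submodule.coe_zero, map_zero, lp.coeFn_zero, Pi.zero_apply]
  by_cases hk : k < 0
  · exact f.2 k hk
  · lift k to ℕ using not_lt.mp hk
    rw [← fourierBasis_repr, HilbertBasis.repr_apply_apply, coe_fourierBasis]
    exact hf _ (Submodule.subset_span ⟨k, rfl⟩)

/-- The monomials `1, t, t², …` as a Hilbert basis of `H²`. -/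
def hardyBasis : HilbertBasis ℕ ℂ H2 :=
  HilbertBasis.mkOfOrthogonalEqBot orthonormal_hardyMonomial orthogonal_span_hardyMonomial

theorem coe_hardyBasis (j : ℕ) : (hardyBasis j : L2) = fourierLp 2 (j : ℤ) := by
  rw [hardyBasis, HilbertBasis.coe_mkOfOrthogonalEqBot, hardyMonomial]

theorem coeFn_mulOp (a : LInf) (f : L2) : mulOp a f =ᵐ[arcMeasure] fun θ => a θ * f θ :=
  (ContinuousLinearMap.mul ℂ ℂ).coeFn_holder a f

/-- The flip operator maps `t ^ k` to `t ^ (-k-1)`. -/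
theorem coeFn_flipOp_fourierLp (k : ℕ) :
    flipOp (fourierLp 2 (k : ℤ)) =ᵐ[arcMeasure] fun θ => fourier (-(k : ℤ) - 1) θ := by
  have hmp := Measure.measurePreserving_neg arcMeasure
  have h1 := coeFn_mulOp (fourierLp ∞ (-1))
    (Lp.compMeasurePreservingₗᵢ ℂ (fun θ : Angles => -θ) hmp (fourierLp 2 (k : ℤ)))
  have h2 := Lp.coeFn_compMeasurePreserving (fourierLp 2 (k : ℤ) : L2) hmp
  have h3 := hmp.quasiMeasurePreserving.ae_eq_comp
    (coeFn_fourierLp (T := 2 * Real.pi) 2 (k : ℤ))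
  have h4 := coeFn_fourierLp (T := 2 * Real.pi) ∞ (-1)
  filter_upwards [h1, h2, h3, h4] with θ e1 e2 e3 e4
  refine e1.trans ?_
  rw [e4]
  have e5 : (Lp.compMeasurePreservingₗᵢ ℂ (fun θ : Angles => -θ) hmp (fourierLp 2 (k : ℤ))) θ
      = fourier (k : ℤ) (-θ) := e2.trans e3
  rw [e5, sub_eq_neg_add, fourier_add, fourier_apply (n := (k : ℤ)), fourier_apply (n := -(k : ℤ))]
  simp

/-- The matrix entries of the Hankel operator `H(a)` are the Fourier coefficients `a_{j+k+1}`. -/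
theorem inner_hankel (a : Circle → ℂ) (ha : EssBounded a) (j k : ℕ) :
    inner ℂ (hardyBasis j) (hankel a ha (hardyBasis k)) =
      fourierCoeff (fun θ : Angles => a θ.toCircle) ((j + k : ℕ) + 1 : ℤ) := by
  have h1 : inner ℂ (hardyBasis j) (hankel a ha (hardyBasis k))
      = inner ℂ (fourierLp 2 (j : ℤ) : L2) (mulOp ha.toLInf (flipOp (fourierLp 2 (k : ℤ)))) := by
    rw [← coe_hardyBasis, ← coe_hardyBasis]
    exact Submodule.inner_orthogonalProjectionOnto_eq_of_mem_left _ _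
  rw [h1, L2.inner_def, fourierCoeff]
  refine integral_congr_ae ?_
  filter_upwards [coeFn_mulOp ha.toLInf (flipOp (fourierLp 2 (k : ℤ))), coeFn_flipOp_fourierLp k,
    MemLp.coeFn_toLp ha, coeFn_fourierLp (T := 2 * Real.pi) 2 (j : ℤ)] with θ e1 e2 e3 e4
  rw [e1, e2, e4]
  have e5 : (ha.toLInf : Angles → ℂ) θ = a θ.toCircle := e3
  rw [e5, RCLike.inner_apply, ← fourier_neg, mul_comm, smul_eq_mul, mul_left_comm, mul_comm,
    ← fourier_add]
  rw [show -(j : ℤ) + (-(k : ℤ) - 1) = -(((j + k : ℕ) : ℤ) + 1) by push_cast; ring]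

end Hardy

/-! ### Integrals of inverse square roots -/

section InvSqrt

theorem inv_sqrt_eq_rpow {x : ℝ} (hx : 0 ≤ x) : (√x)⁻¹ = x ^ (-(1 / 2) : ℝ) := by
  rw [Real.sqrt_eq_rpow, Real.rpow_neg hx]

theorem intervalIntegrable_inv_sqrt {c : ℝ} (hc : 0 ≤ c) :
    IntervalIntegrable (fun x => (√x)⁻¹) volume 0 c := by
  refine (intervalIntegral.intervalIntegrable_rpow' (r := -(1 / 2)) (by norm_num)).congr ?_
  intro x hx
  rw [Set.uIoc_of_le hc] at hx
  exact (inv_sqrt_eq_rpow hx.1.le).symm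

theorem integral_inv_sqrt {c : ℝ} (hc : 0 ≤ c) : ∫ x in (0 : ℝ)..c, (√x)⁻¹ = 2 * √c := by
  have h : ∫ x in (0 : ℝ)..c, (√x)⁻¹ = ∫ x in (0 : ℝ)..c, x ^ (-(1 / 2) : ℝ) := by
    refine intervalIntegral.integral_congr fun x hx => ?_
    rw [Set.uIcc_of_le hc] at hx
    exact inv_sqrt_eq_rpow hx.1
  rw [h, integral_rpow (Or.inl (by norm_num)), Real.sqrt_eq_rpow]
  norm_num
  ring

theorem intervalIntegrable_inv_sqrt_sub_left {a b : ℝ} (hab : a ≤ b) :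
    IntervalIntegrable (fun x => (√(x - a))⁻¹) volume a b := by
  simpa using (intervalIntegrable_inv_sqrt (sub_nonneg.mpr hab)).comp_sub_right a

theorem intervalIntegrable_inv_sqrt_sub_right {a b : ℝ} (hab : a ≤ b) :
    IntervalIntegrable (fun x => (√(b - x))⁻¹) volume a b := by
  simpa using ((intervalIntegrable_inv_sqrt (sub_nonneg.mpr hab)).comp_sub_left b).symm

theorem integral_inv_sqrt_sub_left {a b : ℝ} (hab : a ≤ b) :
    ∫ x in a..b, (√(x - a))⁻¹ = 2 * √(b - a) := by
  rw [intervalIntegral.integral_comp_sub_right (fun x => (√x)⁻¹) a, sub_self,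
    integral_inv_sqrt (sub_nonneg.mpr hab)]

theorem integral_inv_sqrt_sub_right {a b : ℝ} (hab : a ≤ b) :
    ∫ x in a..b, (√(b - x))⁻¹ = 2 * √(b - a) := by
  rw [intervalIntegral.integral_comp_sub_left (fun x => (√x)⁻¹) b, sub_self,
    integral_inv_sqrt (sub_nonneg.mpr hab)]

theorem intervalIntegrable_inv_sqrt_abs_sub {a b c : ℝ} (hab : a ≤ b) (hbc : b ≤ c) :
    IntervalIntegrable (fun x => (√|x - b|)⁻¹) volume a c := by
  refine IntervalIntegrable.trans (b := b) ?_ ?_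
  · refine (intervalIntegrable_inv_sqrt_sub_right hab).congr ?_
    intro x hx
    rw [Set.uIoc_of_le hab] at hx
    simp only
    rw [abs_of_nonpos (by linarith [hx.2]), neg_sub]
  · refine (intervalIntegrable_inv_sqrt_sub_left hbc).congr ?_
    intro x hx
    rw [Set.uIoc_of_le hbc] at hx
    simp only
    rw [abs_of_nonneg (by linarith [hx.1])]

end InvSqrt

/-! ### A contour integral over the upper half disc -/

section Contour

/-- The open upper half plane as a subset of `ℂ`. -/
def upperHalf : Set ℂ := {z | 0 < z.im}

/-- `G` is holomorphic in the upper half plane and has the boundary values `g` on `(-1, 1)`, apart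
from the points `0, ±μ`, and inside the unit disc it is bounded by a multiple of
`||z| - μ|^{-1/2}`. -/
structure HasBoundaryValues (μ : ℝ) (G : ℂ → ℂ) (g : ℝ → ℂ) : Prop where
  differentiableOn : DifferentiableOn ℂ G upperHalf
  bound : ∃ C, ∀ z ∈ upperHalf, ‖z‖ ≤ 1 → ‖z‖ ≠ μ → ‖G z‖ ≤ C * (√|‖z‖ - μ|)⁻¹
  tendsto : ∀ x ∈ Set.Ioo (-1 : ℝ) 1, x ≠ 0 → |x| ≠ μ →
    Tendsto G (𝓝[upperHalf] (x : ℂ)) (𝓝 (g x))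

variable {μ : ℝ} {G : ℂ → ℂ} {g : ℝ → ℂ}

/-- Along rays that approach the real half axis in the direction `σ = ±1`, the radial integrals
converge to the integral of the boundary values. -/
theorem HasBoundaryValues.tendsto_radial (h : HasBoundaryValues μ G g) (hμ : μ ∈ Set.Ico (0 : ℝ) 1)
    (m : ℕ) {σ : ℝ} (hσ : |σ| = 1) {u : ℝ → ℂ} (hu : ∀ ε ∈ Set.Ioo (0 : ℝ) 1, u ε ∈ upperHalf)
    (hu1 : ∀ ε, ‖u ε‖ = 1) (huσ : Tendsto u (𝓝[>] 0) (𝓝 (σ : ℂ))) :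
    Tendsto (fun ε => ∫ r in ε..1, G (r * u ε) * (r * u ε) ^ m * u ε) (𝓝[>] 0)
      (𝓝 (∫ r in (0 : ℝ)..1, g (σ * r) * ((σ * r : ℝ) : ℂ) ^ m * σ)) := by
  obtain ⟨C, hC⟩ := h.bound
  have hmem : ∀ ε ∈ Set.Ioo (0 : ℝ) 1, ∀ r : ℝ, 0 < r → (r : ℂ) * u ε ∈ upperHalf := by
    intro ε hε r hr
    have := hu ε hε
    simp only [upperHalf, Set.mem_ofPred_eq, Complex.im_ofReal_mul] at this ⊢
    positivity
  have hev : ∀ᶠ ε : ℝ in 𝓝[>] 0, ε ∈ Set.Ioo (0 : ℝ) 1 := Ioo_mem_nhdsGT one_pos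
  have hind : ∀ᶠ ε : ℝ in 𝓝[>] 0, ∫ r in (0 : ℝ)..1, (Set.Ioc ε 1).indicator
      (fun r : ℝ => G (r * u ε) * (r * u ε) ^ m * u ε) r
      = ∫ r in ε..1, G (r * u ε) * (r * u ε) ^ m * u ε := by
    filter_upwards [hev] with ε hε
    rw [intervalIntegral.integral_of_le zero_le_one, intervalIntegral.integral_of_le hε.2.le,
      setIntegral_indicator measurableSet_Ioc,
      Set.inter_eq_right.mpr (Set.Ioc_subset_Ioc_left hε.1.le)]
  refine Tendsto.congr' hind ?_
  refine intervalIntegral.tendsto_integral_filter_of_dominated_convergence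
    (fun r => C * (√|r - μ|)⁻¹) ?_ ?_ ?_ ?_
  · filter_upwards [hev] with ε hε
    refine AEStronglyMeasurable.restrict ?_
    rw [aestronglyMeasurable_indicator_iff measurableSet_Ioc]
    refine ContinuousOn.aestronglyMeasurable ?_ measurableSet_Ioc
    have hc : ContinuousOn (fun r : ℝ => G (r * u ε)) (Set.Ioc ε 1) :=
      h.differentiableOn.continuousOn.comp (by fun_prop)
        fun r hr => hmem ε hε r (hε.1.trans hr.1)
    exact (hc.mul (by fun_prop)).mul continuousOn_const
  · filter_upwards [hev] with ε hε
    have hne : ∀ᵐ r : ℝ, r ≠ μ := by simp [ae_iff]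
    filter_upwards [hne] with r hrμ hr
    rw [Set.uIoc_of_le zero_le_one] at hr
    have hnorm : ‖(r : ℂ) * u ε‖ = r := by
      rw [norm_mul, hu1, mul_one, Complex.norm_real, Real.norm_eq_abs, abs_of_pos hr.1]
    have hb := hC _ (hmem ε hε r hr.1) (by rw [hnorm]; exact hr.2) (by rwa [hnorm])
    rw [hnorm] at hb
    refine (norm_indicator_le_norm_self _ _).trans ?_
    rw [norm_mul, norm_mul, hu1, mul_one, norm_pow, hnorm]
    exact (mul_le_of_le_one_right (norm_nonneg _) (pow_le_one₀ hr.1.le hr.2)).trans hb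
  · exact (intervalIntegrable_inv_sqrt_abs_sub hμ.1 hμ.2.le).const_mul C
  · have hne : ∀ᵐ r : ℝ, r ≠ μ ∧ r ≠ 1 := by
      refine Filter.Eventually.and ?_ ?_ <;> simp [ae_iff]
    filter_upwards [hne] with r hrμ hr
    rw [Set.uIoc_of_le zero_le_one] at hr
    have hr1 : r < 1 := lt_of_le_of_ne hr.2 hrμ.2
    have hσr : |σ * r| = r := by rw [abs_mul, hσ, one_mul, abs_of_pos hr.1]
    have hlim : Tendsto (fun ε => (r : ℂ) * u ε) (𝓝[>] 0) (𝓝 ((σ * r : ℝ) : ℂ)) := by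
      have := huσ.const_mul (r : ℂ)
      rwa [mul_comm, ← Complex.ofReal_mul] at this
    have hlim2 : Tendsto (fun ε => (r : ℂ) * u ε) (𝓝[>] 0)
        (𝓝[upperHalf] ((σ * r : ℝ) : ℂ)) :=
      tendsto_nhdsWithin_iff.mpr ⟨hlim, hev.mono fun ε hε => hmem ε hε r hr.1⟩
    have hG := (h.tendsto (σ * r) (abs_lt.mp (by rwa [hσr]))
      (abs_pos.mp (by rw [hσr]; exact hr.1)) (by rw [hσr]; exact hrμ.1)).comp hlim2
    refine Tendsto.congr' ?_ ((hG.mul (hlim.pow m)).mul huσ)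
    filter_upwards [Ioo_mem_nhdsGT hr.1] with ε hε
    rw [Set.indicator_of_mem (show r ∈ Set.Ioc ε 1 from ⟨hε.2, hr.2⟩)]
    rfl

theorem exp_log_add_mul_I {r : ℝ} (hr : 0 < r) (θ : ℝ) :
    Complex.exp ((Real.log r : ℝ) + θ * Complex.I) = r * Complex.exp (θ * Complex.I) := by
  rw [Complex.exp_add, ← Complex.ofReal_exp, Real.exp_log hr]

theorem exp_mem_upperHalf {ζ : ℂ} (h0 : 0 < ζ.im) (h1 : ζ.im < Real.pi) :
    Complex.exp ζ ∈ upperHalf := by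
  simp only [upperHalf, Set.mem_ofPred_eq, Complex.exp_im]
  have := Real.sin_pos_of_pos_of_lt_pi h0 h1
  positivity

/-- Cauchy's theorem for a half annulus with the sectors near the real axis cut off, which is a
rectangle in logarithmic coordinates. -/
theorem integral_sector_eq_zero (hG : DifferentiableOn ℂ G upperHalf) (m : ℕ) {ε : ℝ}
    (hε : ε ∈ Set.Ioo (0 : ℝ) 1) :
    (∫ r in ε..1, G (r * Complex.exp (ε * Complex.I)) * (r * Complex.exp (ε * Complex.I)) ^ m *
        Complex.exp (ε * Complex.I)) -
      (∫ r in ε..1, G (r * Complex.exp ((Real.pi - ε : ℝ) * Complex.I)) *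
        (r * Complex.exp ((Real.pi - ε : ℝ) * Complex.I)) ^ m *
        Complex.exp ((Real.pi - ε : ℝ) * Complex.I)) +
      Complex.I * (∫ θ in ε..(Real.pi - ε), G (Complex.exp (θ * Complex.I)) *
        Complex.exp (θ * Complex.I) ^ (m + 1)) -
      Complex.I * (∫ θ in ε..(Real.pi - ε), G (ε * Complex.exp (θ * Complex.I)) *
        (ε * Complex.exp (θ * Complex.I)) ^ (m + 1)) = 0 := by
  have hpi := Real.pi_gt_three
  have hε0 := hε.1
  have hε1 := hε.2
  have hle : ε ≤ Real.pi - ε := by linarith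
  have hray : ∀ α ∈ Set.Ioo 0 Real.pi, ∫ x in Real.log ε..0,
      G (Complex.exp (x + α * Complex.I)) * Complex.exp (x + α * Complex.I) ^ (m + 1)
      = ∫ r in ε..1, G (r * Complex.exp (α * Complex.I)) *
        (r * Complex.exp (α * Complex.I)) ^ m * Complex.exp (α * Complex.I) := by
    intro α hα
    have h1 := intervalIntegral.integral_deriv_smul_comp' (a := Real.log ε) (b := 0)
      (f := Real.exp) (f' := Real.exp) (g := fun r : ℝ => G (r * Complex.exp (α * Complex.I)) *
        (r * Complex.exp (α * Complex.I)) ^ m * Complex.exp (α * Complex.I))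
      (fun x _ => Real.hasDerivAt_exp x) Real.continuous_exp.continuousOn
      (by
        have hmaps : Set.MapsTo (fun r : ℝ => (r : ℂ) * Complex.exp (α * Complex.I))
            (Real.exp '' Set.uIcc (Real.log ε) 0) upperHalf := by
          rintro _ ⟨x, _, rfl⟩
          simp only
          rw [Complex.ofReal_exp, ← Complex.exp_add]
          exact exp_mem_upperHalf (by simpa using hα.1) (by simpa using hα.2)
        exact ((hG.continuousOn.comp (by fun_prop) hmaps).mul (by fun_prop)).mul
          continuousOn_const)
    rw [Real.exp_log hε0, Real.exp_zero] at h1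
    rw [← h1]
    refine intervalIntegral.integral_congr fun x _ => ?_
    simp only [Function.comp_apply, Complex.exp_add, Complex.real_smul, Complex.ofReal_exp]
    ring
  have key := Complex.integral_boundary_rect_eq_zero_of_differentiableOn
    (fun ζ => G (Complex.exp ζ) * Complex.exp ζ ^ (m + 1))
    ⟨Real.log ε, ε⟩ ⟨0, Real.pi - ε⟩ (by
      have hmaps : Set.MapsTo Complex.exp
          (Set.uIcc (Real.log ε) 0 ×ℂ Set.uIcc ε (Real.pi - ε)) upperHalf := by
        intro ζ hζ
        have h2 := hζ.2
        rw [Set.mem_preimage, Set.uIcc_of_le hle] at h2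
        exact exp_mem_upperHalf (by linarith [h2.1]) (by linarith [h2.2])
      exact (hG.comp Complex.differentiable_exp.differentiableOn hmaps).mul (by fun_prop))
  simp only [smul_eq_mul] at key
  rw [hray ε ⟨hε0, by linarith⟩, hray (Real.pi - ε) ⟨by linarith, by linarith⟩] at key
  simp_rw [exp_log_add_mul_I hε0] at key
  simpa using key

/-- The boundary values inherit measurability and the bound from `G`. -/
theorem HasBoundaryValues.integrableOn (h : HasBoundaryValues μ G g)
    (hμ : μ ∈ Set.Ico (0 : ℝ) 1) : IntegrableOn g (Set.Ioo (-1 : ℝ) 1) := by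
  obtain ⟨C, hC⟩ := h.bound
  have hne : ∀ᵐ x : ℝ ∂(volume.restrict (Set.Ioo (-1 : ℝ) 1)),
      x ∈ Set.Ioo (-1 : ℝ) 1 ∧ x ≠ 0 ∧ |x| ≠ μ := by
    refine Filter.Eventually.and (ae_restrict_mem measurableSet_Ioo) (ae_restrict_of_ae ?_)
    refine Filter.Eventually.and (by simp [ae_iff]) ?_
    have h1 : ∀ᵐ x : ℝ, x ≠ μ ∧ x ≠ -μ := by
      refine Filter.Eventually.and ?_ ?_ <;> simp [ae_iff]
    filter_upwards [h1] with x hx hxμ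
    rcases eq_or_eq_neg_of_abs_eq hxμ with h2 | h2
    · exact hx.1 h2
    · exact hx.2 h2
  have happ : ∀ x : ℝ, Tendsto (fun n : ℕ => (x : ℂ) + (1 / ((n : ℝ) + 1) : ℝ) * Complex.I) atTop
      (𝓝[upperHalf] (x : ℂ)) := by
    intro x
    refine tendsto_nhdsWithin_iff.mpr ⟨?_, Eventually.of_forall fun n => ?_⟩
    · have h1 := (Complex.continuous_ofReal.tendsto 0).comp
        (tendsto_one_div_add_atTop_nhds_zero_nat (𝕜 := ℝ))
      simpa using (h1.mul_const Complex.I).const_add (x : ℂ)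
    · simp only [upperHalf, Set.mem_ofPred_eq, Complex.add_im, Complex.ofReal_im, Complex.mul_I_im,
        Complex.ofReal_re, zero_add]
      positivity
  have hmeas : AEStronglyMeasurable g (volume.restrict (Set.Ioo (-1 : ℝ) 1)) := by
    refine aestronglyMeasurable_of_tendsto_ae atTop
      (f := fun (n : ℕ) (x : ℝ) => G ((x : ℂ) + (1 / ((n : ℝ) + 1) : ℝ) * Complex.I))
      (fun n => ?_) ?_
    · refine Continuous.aestronglyMeasurable ?_
      refine h.differentiableOn.continuousOn.comp_continuous (by fun_prop) fun x => ?_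
      simp only [upperHalf, Set.mem_ofPred_eq, Complex.add_im, Complex.ofReal_im, Complex.mul_I_im,
        Complex.ofReal_re, zero_add]
      positivity
    · filter_upwards [hne] with x hx
      exact (h.tendsto x hx.1 hx.2.1 hx.2.2).comp (happ x)
  have hdom : IntegrableOn (fun x : ℝ => C * (√|(|x| - μ)|)⁻¹) (Set.Ioo (-1 : ℝ) 1) := by
    have hpos : IntervalIntegrable (fun x : ℝ => C * (√|(|x| - μ)|)⁻¹) volume 0 1 := by
      refine ((intervalIntegrable_inv_sqrt_abs_sub hμ.1 hμ.2.le).const_mul C).congr ?_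
      intro x hx
      rw [Set.uIoc_of_le zero_le_one] at hx
      simp only
      rw [abs_of_pos hx.1]
    have hneg : IntervalIntegrable (fun x : ℝ => C * (√|(|x| - μ)|)⁻¹) volume (-1) 0 := by
      have h1 := (IntervalIntegrable.iff_comp_neg (f := fun x : ℝ => C * (√|(|x| - μ)|)⁻¹)
        (a := 0) (b := 1)).mp hpos
      simpa using h1.symm
    have h2 := hneg.trans hpos
    rw [intervalIntegrable_iff_integrableOn_Ioc_of_le (by norm_num)] at h2
    exact h2.mono_set Set.Ioo_subset_Ioc_self
  refine hdom.mono' hmeas ?_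
  filter_upwards [hne] with x hx
  have hnorm : Tendsto (fun z : ℂ => ‖z‖) (𝓝[upperHalf] (x : ℂ)) (𝓝 |x|) := by
    have h1 := (continuous_norm (E := ℂ)).tendsto (x : ℂ)
    rw [Complex.norm_real, Real.norm_eq_abs] at h1
    exact h1.mono_left nhdsWithin_le_nhds
  have hbd : Tendsto (fun z : ℂ => C * (√|‖z‖ - μ|)⁻¹) (𝓝[upperHalf] (x : ℂ))
      (𝓝 (C * (√|(|x| - μ)|)⁻¹)) := by
    refine Tendsto.const_mul C (Tendsto.inv₀ ?_ ?_)
    · exact ((Real.continuous_sqrt.comp continuous_abs).tendsto _).comp (hnorm.sub_const μ)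
    · exact Real.sqrt_ne_zero'.mpr (abs_pos.mpr (sub_ne_zero.mpr hx.2.2))
  have hne_bot : (𝓝[upperHalf] (x : ℂ)).NeBot := (happ x).neBot
  refine le_of_tendsto_of_tendsto (h.tendsto x hx.1 hx.2.1 hx.2.2).norm hbd ?_
  filter_upwards [self_mem_nhdsWithin, hnorm.eventually_lt_const (abs_lt.mpr hx.1),
    hnorm.eventually_ne hx.2.2] with z h1 h2 h3
  exact hC z h1 h2.le h3

theorem HasBoundaryValues.integrableOn_arc (h : HasBoundaryValues μ G g)
    (hμ : μ ∈ Set.Ico (0 : ℝ) 1) (m : ℕ) :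
    IntegrableOn (fun θ : ℝ => G (Complex.exp (θ * Complex.I)) *
      Complex.exp (θ * Complex.I) ^ (m + 1)) (Set.Ioo 0 Real.pi) := by
  obtain ⟨C, hC⟩ := h.bound
  have hexp : ∀ θ ∈ Set.Ioo (0 : ℝ) Real.pi, Complex.exp (θ * Complex.I) ∈ upperHalf :=
    fun θ hθ => exp_mem_upperHalf (by simpa using hθ.1) (by simpa using hθ.2)
  refine IntegrableOn.of_bound (by simp) ?_ (C * (√|1 - μ|)⁻¹) ?_
  · refine ContinuousOn.aestronglyMeasurable ?_ measurableSet_Ioo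
    exact (h.differentiableOn.continuousOn.comp (by fun_prop) hexp).mul (by fun_prop)
  · refine (ae_restrict_iff' measurableSet_Ioo).mpr (Eventually.of_forall fun θ hθ => ?_)
    have hn := Complex.norm_exp_ofReal_mul_I θ
    have h1 := hC _ (hexp θ hθ) hn.le (by rw [hn]; exact hμ.2.ne')
    rw [hn] at h1
    rwa [norm_mul, norm_pow, hn, one_pow, mul_one]

/-- Cauchy's theorem for the upper half disc, as the limit of the one for the truncated half annuli.
The singularities of the boundary values at `0` and `±μ` are integrable and do not contribute. -/
theorem HasBoundaryValues.integral_arc (h : HasBoundaryValues μ G g) (hμ : μ ∈ Set.Ico (0 : ℝ) 1)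
    (m : ℕ) :
    Complex.I * (∫ θ in (0 : ℝ)..Real.pi, G (Complex.exp (θ * Complex.I)) *
        Complex.exp (θ * Complex.I) ^ (m + 1)) +
      ∫ x in Set.Ioo (-1 : ℝ) 1, g x * (x : ℂ) ^ m = 0 := by
  have hpi := Real.pi_gt_three
  obtain ⟨C, hC⟩ := h.bound
  have hev : ∀ᶠ ε : ℝ in 𝓝[>] 0, ε ∈ Set.Ioo (0 : ℝ) 1 := Ioo_mem_nhdsGT one_pos
  have hexp : ∀ θ ∈ Set.Ioo (0 : ℝ) Real.pi, Complex.exp (θ * Complex.I) ∈ upperHalf :=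
    fun θ hθ => exp_mem_upperHalf (by simpa using hθ.1) (by simpa using hθ.2)
  -- the two segments on the real axis
  have hA := h.tendsto_radial hμ m (σ := 1) (by simp)
    (u := fun ε => Complex.exp (ε * Complex.I))
    (fun ε hε => hexp ε ⟨hε.1, by linarith [hε.2]⟩) (fun ε => Complex.norm_exp_ofReal_mul_I ε)
    (by
      have hc : Continuous fun ε : ℝ => Complex.exp (ε * Complex.I) := by fun_prop
      have := hc.tendsto 0
      simp only [Complex.ofReal_zero, zero_mul, Complex.exp_zero] at this
      simpa using this.mono_left nhdsWithin_le_nhds)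
  have hB := h.tendsto_radial hμ m (σ := -1) (by simp)
    (u := fun ε => Complex.exp ((Real.pi - ε : ℝ) * Complex.I))
    (fun ε hε => hexp _ ⟨by linarith [hε.2], by linarith [hε.1]⟩)
    (fun ε => Complex.norm_exp_ofReal_mul_I _)
    (by
      have hc : Continuous fun ε : ℝ => Complex.exp ((Real.pi - ε : ℝ) * Complex.I) := by fun_prop
      have := hc.tendsto 0
      simp only [sub_zero, Complex.exp_pi_mul_I] at this
      simpa using this.mono_left nhdsWithin_le_nhds)
  -- the large arc
  have hint := h.integrableOn_arc hμ m
  have hcov : AECover (volume.restrict (Set.Ioo (0 : ℝ) Real.pi)) (𝓝[>] (0 : ℝ))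
      fun ε => Set.Ioc ε (Real.pi - ε) := by
    refine aecover_Ioo_of_Ioc (tendsto_nhdsWithin_of_tendsto_nhds tendsto_id) ?_
    have hc : Continuous fun ε : ℝ => Real.pi - ε := by fun_prop
    have := hc.tendsto 0
    rw [sub_zero] at this
    exact this.mono_left nhdsWithin_le_nhds
  have hD : Tendsto (fun ε => ∫ θ in ε..(Real.pi - ε), G (Complex.exp (θ * Complex.I)) *
      Complex.exp (θ * Complex.I) ^ (m + 1)) (𝓝[>] (0 : ℝ))
      (𝓝 (∫ θ in (0 : ℝ)..Real.pi, G (Complex.exp (θ * Complex.I)) *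
        Complex.exp (θ * Complex.I) ^ (m + 1))) := by
    have h1 := hcov.integral_tendsto_of_countably_generated hint
    rw [intervalIntegral.integral_of_le Real.pi_pos.le, integral_Ioc_eq_integral_Ioo]
    refine h1.congr' ?_
    filter_upwards [hev] with ε hε
    have hε1 := hε.2
    have hε0 := hε.1
    rw [intervalIntegral.integral_of_le (by linarith), Measure.restrict_restrict measurableSet_Ioc,
      Set.inter_eq_left.mpr]
    exact fun θ hθ => ⟨hε0.trans hθ.1, by linarith [hθ.2]⟩
  -- the small arc
  have hS : Tendsto (fun ε : ℝ => ∫ θ in ε..(Real.pi - ε), G (ε * Complex.exp (θ * Complex.I)) *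
      (ε * Complex.exp (θ * Complex.I)) ^ (m + 1)) (𝓝[>] (0 : ℝ)) (𝓝 0) := by
    have hsmall : Tendsto (fun ε : ℝ => C * (ε * (√|ε - μ|)⁻¹) * Real.pi) (𝓝[>] (0 : ℝ)) (𝓝 0) := by
      have h0 : Tendsto (fun ε : ℝ => ε * (√|ε - μ|)⁻¹) (𝓝[>] (0 : ℝ)) (𝓝 0) := by
        rcases hμ.1.eq_or_lt with h0 | h0
        · have h1 : Tendsto (fun ε : ℝ => √ε) (𝓝[>] (0 : ℝ)) (𝓝 0) := by
            have := Real.continuous_sqrt.tendsto 0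
            rw [Real.sqrt_zero] at this
            exact this.mono_left nhdsWithin_le_nhds
          refine h1.congr' ?_
          filter_upwards [self_mem_nhdsWithin] with ε hε
          have hε : 0 < ε := hε
          rw [← h0, sub_zero, abs_of_pos hε, ← div_eq_mul_inv, Real.div_sqrt]
        · have h1 : ContinuousAt (fun ε : ℝ => ε * (√|ε - μ|)⁻¹) 0 := by
            refine continuousAt_id.mul (ContinuousAt.inv₀ (by fun_prop) ?_)
            exact Real.sqrt_ne_zero'.mpr (abs_pos.mpr (by linarith))
          have h2 := h1.tendsto
          simp only [zero_mul] at h2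
          exact h2.mono_left nhdsWithin_le_nhds
      simpa using (h0.const_mul C).mul_const Real.pi
    have hne : ∀ᶠ ε : ℝ in 𝓝[>] 0, ε ≠ μ := by
      rcases hμ.1.eq_or_lt with h0 | h0
      · filter_upwards [self_mem_nhdsWithin] with ε hε
        rw [← h0]
        exact ne_of_gt hε
      · filter_upwards [Ioo_mem_nhdsGT h0] with ε hε
        exact hε.2.ne
    refine squeeze_zero_norm' ?_ hsmall
    filter_upwards [hev, hne] with ε hε hεμ
    have hε1 := hε.2
    have hε0 := hε.1
    have hC0 : 0 ≤ C * (√|ε - μ|)⁻¹ := by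
      have hI := hexp 1 ⟨one_pos, by linarith⟩
      have hn : ‖(ε : ℂ) * Complex.exp ((1 : ℝ) * Complex.I)‖ = ε := by
        rw [norm_mul, Complex.norm_exp_ofReal_mul_I, mul_one, Complex.norm_real, Real.norm_eq_abs,
          abs_of_pos hε0]
      have h1 := hC (ε * Complex.exp ((1 : ℝ) * Complex.I))
        (by
          simp only [upperHalf, Set.mem_ofPred_eq, Complex.im_ofReal_mul] at hI ⊢
          positivity) (by rw [hn]; exact hε1.le) (by rwa [hn])
      rw [hn] at h1
      exact (norm_nonneg _).trans h1
    refine (intervalIntegral.norm_integral_le_of_norm_le_const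
      (C := C * (ε * (√|ε - μ|)⁻¹)) fun θ hθ => ?_).trans ?_
    · rw [Set.uIoc_of_le (by linarith)] at hθ
      have hI := hexp θ ⟨by linarith [hθ.1], by linarith [hθ.2]⟩
      have hn : ‖(ε : ℂ) * Complex.exp (θ * Complex.I)‖ = ε := by
        rw [norm_mul, Complex.norm_exp_ofReal_mul_I, mul_one, Complex.norm_real, Real.norm_eq_abs,
          abs_of_pos hε0]
      have h1 := hC (ε * Complex.exp (θ * Complex.I))
        (by
          simp only [upperHalf, Set.mem_ofPred_eq, Complex.im_ofReal_mul] at hI ⊢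
          positivity) (by rw [hn]; exact hε1.le) (by rwa [hn])
      rw [hn] at h1
      rw [norm_mul, norm_pow, hn]
      calc _ ≤ C * (√|ε - μ|)⁻¹ * ε := by
            refine mul_le_mul h1 ?_ (by positivity) hC0
            exact pow_le_of_le_one hε0.le hε1.le (by omega)
        _ = _ := by ring
    · refine mul_le_mul_of_nonneg_left ?_ ?_
      · rw [abs_of_nonneg (by linarith)]
        linarith
      · calc (0 : ℝ) ≤ C * (√|ε - μ|)⁻¹ * ε := mul_nonneg hC0 hε0.le
          _ = _ := by ring
  have hlim := ((hA.sub hB).add (hD.const_mul Complex.I)).sub (hS.const_mul Complex.I)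
  have hzero := tendsto_nhds_unique (hlim.congr' (by
    filter_upwards [hev] with ε hε
    exact integral_sector_eq_zero h.differentiableOn m hε)) tendsto_const_nhds
  -- the two segments together
  have hgi : IntervalIntegrable (fun x => g x * (x : ℂ) ^ m) volume (-1) 1 := by
    rw [intervalIntegrable_iff_integrableOn_Ioo_of_le (by norm_num)]
    refine Integrable.mono (h.integrableOn hμ) ?_ ?_
    · exact (h.integrableOn hμ).aestronglyMeasurable.mul
        (by fun_prop : Continuous fun x : ℝ => (x : ℂ) ^ m).aestronglyMeasurable
    · refine (ae_restrict_iff' measurableSet_Ioo).mpr (Eventually.of_forall fun x hx => ?_)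
      rw [norm_mul]
      exact mul_le_of_le_one_right (norm_nonneg _) (norm_pow_le_one hx m)
  have hsplit : ∫ x in Set.Ioo (-1 : ℝ) 1, g x * (x : ℂ) ^ m
      = (∫ r in (0 : ℝ)..1, g (1 * r) * ((1 * r : ℝ) : ℂ) ^ m * (1 : ℝ)) -
        ∫ r in (0 : ℝ)..1, g (-1 * r) * ((-1 * r : ℝ) : ℂ) ^ m * (-1 : ℝ) := by
    rw [← integral_Ioc_eq_integral_Ioo, ← intervalIntegral.integral_of_le (by norm_num),
      ← intervalIntegral.integral_add_adjacent_intervals (b := 0)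
        (hgi.mono_set (by
          rw [Set.uIcc_of_le (by norm_num), Set.uIcc_of_le (by norm_num)]
          exact Set.Icc_subset_Icc_right (by norm_num)))
        (hgi.mono_set (by
          rw [Set.uIcc_of_le (by norm_num), Set.uIcc_of_le (by norm_num)]
          exact Set.Icc_subset_Icc_left (by norm_num)))]
    have h1 := intervalIntegral.integral_comp_neg (a := 0) (b := 1)
      (fun x : ℝ => g x * (x : ℂ) ^ m)
    rw [neg_zero] at h1
    rw [← h1, add_comm, sub_eq_add_neg, ← intervalIntegral.integral_neg]
    congr 1 <;> refine intervalIntegral.integral_congr fun x _ => ?_ <;> simp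
  rw [hsplit]
  simpa [add_comm] using hzero

end Contour

/-! ### Fourier coefficients of positive index as moments -/

section Symbols

variable {μ : ℝ} {G : ℂ → ℂ} {g : ℝ → ℂ}

/-- If a symbol `ψ` satisfies `ψ(t̄) = G(t)` and `ψ(t) = conj (G(t))` on the upper half circle, then
its Fourier coefficients of positive index are moments of the density `-Im g / π`. -/
theorem HasBoundaryValues.fourierCoeff_eq (h : HasBoundaryValues μ G g)
    (hμ : μ ∈ Set.Ico (0 : ℝ) 1) {ψ : Circle → ℂ}
    (hψ : ∀ θ ∈ Set.Ioo 0 Real.pi,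
      ψ (Circle.exp θ) = starRingEnd ℂ (G (Complex.exp (θ * Complex.I))))
    (hψ' : ∀ θ ∈ Set.Ioo 0 Real.pi, ψ (Circle.exp (-θ)) = G (Complex.exp (θ * Complex.I)))
    (m : ℕ) :
    fourierCoeff (fun θ : Angles => ψ θ.toCircle) ((m : ℤ) + 1) =
      ∫ x in Set.Ioo (-1 : ℝ) 1, ((-(g x).im / Real.pi : ℝ) : ℂ) * (x : ℂ) ^ m := by
  have hpi := Real.pi_pos
  set K := ∫ θ in (0 : ℝ)..Real.pi, G (Complex.exp (θ * Complex.I)) *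
    Complex.exp (θ * Complex.I) ^ (m + 1) with hK
  have hKi := h.integrableOn_arc hμ m
  set F : ℝ → ℂ := fun θ =>
    fourier (-((m : ℤ) + 1)) (θ : Angles) • ψ (AddCircle.toCircle (θ : Angles))
    with hF
  have hF1 : ∀ θ ∈ Set.Ioo 0 Real.pi, F θ = starRingEnd ℂ (G (Complex.exp (θ * Complex.I)) *
      Complex.exp (θ * Complex.I) ^ (m + 1)) := by
    intro θ hθ
    have h1 : (AddCircle.toCircle (θ : Angles)) = Circle.exp θ := by
      rw [AddCircle.toCircle_apply_mk]
      congr 1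
      field_simp
    rw [hF]
    simp only
    rw [h1, hψ θ hθ, map_mul, map_pow, ← Complex.exp_conj, fourier_coe_apply, smul_eq_mul, mul_comm,
      ← Complex.exp_nat_mul]
    congr 2
    simp
    field_simp
    ring
  have hF2 : ∀ θ ∈ Set.Ioo 0 Real.pi, F (-θ) = G (Complex.exp (θ * Complex.I)) *
      Complex.exp (θ * Complex.I) ^ (m + 1) := by
    intro θ hθ
    have h1 : (AddCircle.toCircle ((-θ : ℝ) : Angles)) = Circle.exp (-θ) := by
      rw [AddCircle.toCircle_apply_mk]
      congr 1
      field_simp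
    rw [hF]
    simp only
    rw [h1, hψ' θ hθ, fourier_coe_apply, smul_eq_mul, mul_comm, ← Complex.exp_nat_mul]
    congr 2
    simp
    field_simp
    ring
  have hi1 : IntervalIntegrable F volume 0 Real.pi := by
    rw [intervalIntegrable_iff_integrableOn_Ioo_of_le hpi.le]
    refine IntegrableOn.congr_fun (f := fun θ : ℝ => starRingEnd ℂ
      (G (Complex.exp (θ * Complex.I)) * Complex.exp (θ * Complex.I) ^ (m + 1))) ?_
      (fun θ hθ => (hF1 θ hθ).symm) measurableSet_Ioo
    exact (Complex.conjCLE.toContinuousLinearMap).integrable_comp hKi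
  have hi2 : IntervalIntegrable F volume (-Real.pi) 0 := by
    have h1 : IntervalIntegrable (fun θ => F (-θ)) volume 0 Real.pi := by
      rw [intervalIntegrable_iff_integrableOn_Ioo_of_le hpi.le]
      exact IntegrableOn.congr_fun hKi (fun θ hθ => (hF2 θ hθ).symm) measurableSet_Ioo
    have h2 := (IntervalIntegrable.iff_comp_neg (f := fun θ => F (-θ))).mp h1
    simpa using h2.symm
  have hI1 : ∫ θ in (0 : ℝ)..Real.pi, F θ = starRingEnd ℂ K := by
    rw [hK, intervalIntegral.integral_of_le hpi.le, intervalIntegral.integral_of_le hpi.le,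
      integral_Ioc_eq_integral_Ioo, integral_Ioc_eq_integral_Ioo, ← integral_conj]
    exact setIntegral_congr_fun measurableSet_Ioo hF1
  have hI2 : ∫ θ in (-Real.pi)..0, F θ = K := by
    have h1 := intervalIntegral.integral_comp_neg (a := 0) (b := Real.pi) F
    rw [neg_zero] at h1
    rw [← h1, hK, intervalIntegral.integral_of_le hpi.le, intervalIntegral.integral_of_le hpi.le,
      integral_Ioc_eq_integral_Ioo, integral_Ioc_eq_integral_Ioo]
    exact setIntegral_congr_fun measurableSet_Ioo hF2
  have hgi : IntegrableOn (fun x => g x * (x : ℂ) ^ m) (Set.Ioo (-1 : ℝ) 1) := by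
    refine Integrable.mono (h.integrableOn hμ) ?_ ?_
    · exact (h.integrableOn hμ).aestronglyMeasurable.mul
        (by fun_prop : Continuous fun x : ℝ => (x : ℂ) ^ m).aestronglyMeasurable
    · refine (ae_restrict_iff' measurableSet_Ioo).mpr (Eventually.of_forall fun x hx => ?_)
      rw [norm_mul]
      exact mul_le_of_le_one_right (norm_nonneg _) (norm_pow_le_one hx m)
  have harc := h.integral_arc hμ m
  rw [← hK] at harc
  have hre : K.re = -∫ x in Set.Ioo (-1 : ℝ) 1, (g x).im * x ^ m := by
    have h1 := congrArg Complex.im harc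
    rw [Complex.add_im, Complex.I_mul_im, Complex.zero_im] at h1
    have h2 : (∫ x in Set.Ioo (-1 : ℝ) 1, g x * (x : ℂ) ^ m).im
        = ∫ x in Set.Ioo (-1 : ℝ) 1, (g x).im * x ^ m := by
      have h3 := Complex.imCLM.integral_comp_comm hgi
      simp only [Complex.imCLM_apply] at h3
      rw [← h3]
      refine integral_congr_ae (Eventually.of_forall fun x => ?_)
      simp only
      rw [← Complex.ofReal_pow, Complex.im_mul_ofReal]
    linarith
  -- the two halves of the circle contribute `K` and its conjugate
  have hsum : K + starRingEnd ℂ K = ((2 * K.re : ℝ) : ℂ) := Complex.add_conj K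
  rw [fourierCoeff_eq_intervalIntegral _ _ (-Real.pi),
    show -Real.pi + 2 * Real.pi = Real.pi by ring,
    ← intervalIntegral.integral_add_adjacent_intervals hi2 hi1, hI1, hI2, hsum, hre]
  have hcast : ∀ x : ℝ, ((-(g x).im / Real.pi : ℝ) : ℂ) * (x : ℂ) ^ m
      = ((-(1 / Real.pi) * ((g x).im * x ^ m) : ℝ) : ℂ) := by
    intro x
    push_cast
    ring
  simp_rw [hcast]
  rw [integral_complex_ofReal, integral_const_mul, Complex.real_smul, ← Complex.ofReal_mul]
  congr 1
  field_simp

theorem HasBoundaryValues.hasMomentMatrix (h : HasBoundaryValues μ G g)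
    (hμ : μ ∈ Set.Ico (0 : ℝ) 1) {ψ : Circle → ℂ} (hb : EssBounded ψ)
    (hψ : ∀ θ ∈ Set.Ioo 0 Real.pi,
      ψ (Circle.exp θ) = starRingEnd ℂ (G (Complex.exp (θ * Complex.I))))
    (hψ' : ∀ θ ∈ Set.Ioo 0 Real.pi, ψ (Circle.exp (-θ)) = G (Complex.exp (θ * Complex.I))) :
    HasMomentMatrix hardyBasis (hankel ψ hb) fun x => -(g x).im / Real.pi := by
  intro j k
  rw [inner_hankel]
  exact h.fourierCoeff_eq hμ hψ hψ' (j + k)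

end Symbols

/-! ### The square root of a Blaschke factor -/

section Blaschke

/-- The Blaschke factor `(μ - z) / (1 - μ z)`. -/
def blaschke (μ : ℝ) (z : ℂ) : ℂ := (μ - z) / (1 - μ * z)

/-- The principal square root of the Blaschke factor, holomorphic off the real axis. -/
def sqrtBlaschke (μ : ℝ) (z : ℂ) : ℂ := Complex.exp (Complex.log (blaschke μ z) / 2)

/-- The boundary values on `(-1, 1)` of `sqrtBlaschke` from the upper half plane. Its cut is
`(μ, 1)`, where they are negative imaginary. -/
def sqrtBlaschkeBoundary (μ x : ℝ) : ℂ :=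
  if x ≤ μ then (√((μ - x) / (1 - μ * x)) : ℝ) else
    -(√((x - μ) / (1 - μ * x)) : ℝ) * Complex.I

variable {μ : ℝ}

theorem one_sub_mul_ne_zero (hμ : μ ∈ Set.Ico (0 : ℝ) 1) {z : ℂ} (hz : z.im ≠ 0 ∨ ‖z‖ ≤ 1) :
    (1 : ℂ) - μ * z ≠ 0 := by
  intro h
  rcases hz with hz | hz
  · have h1 := congrArg Complex.im h
    have h2 := congrArg Complex.re h
    simp at h1 h2
    rcases h1 with h1 | h1
    · rw [h1] at h2
      simp at h2
    · exact hz h1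
  · have h1 : ‖(μ : ℂ) * z‖ = 1 := by rw [← sub_eq_zero.mp h, norm_one]
    rw [norm_mul, Complex.norm_real, Real.norm_eq_abs, abs_of_nonneg hμ.1] at h1
    nlinarith [hμ.1, hμ.2, norm_nonneg z]

theorem blaschke_im (μ : ℝ) (z : ℂ) :
    (blaschke μ z).im = -((1 - μ ^ 2) * z.im / Complex.normSq (1 - μ * z)) := by
  rw [blaschke, Complex.div_im]
  simp
  ring

theorem blaschke_im_neg (hμ : μ ∈ Set.Ico (0 : ℝ) 1) {z : ℂ} (hz : z ∈ upperHalf) :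
    (blaschke μ z).im < 0 := by
  have hz : 0 < z.im := hz
  have h1 : 0 < Complex.normSq (1 - μ * z) :=
    Complex.normSq_pos.mpr (one_sub_mul_ne_zero hμ (Or.inl hz.ne'))
  have h2 : 0 < 1 - μ ^ 2 := by nlinarith [hμ.1, hμ.2]
  rw [blaschke_im, neg_lt_zero]
  positivity

theorem blaschke_im_ne_zero (hμ : μ ∈ Set.Ico (0 : ℝ) 1) {z : ℂ} (hz : z.im ≠ 0) :
    (blaschke μ z).im ≠ 0 := by
  have h1 : Complex.normSq (1 - μ * z) ≠ 0 :=
    (Complex.normSq_pos.mpr (one_sub_mul_ne_zero hμ (Or.inl hz))).ne'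
  have h2 : 1 - μ ^ 2 ≠ 0 := by nlinarith [hμ.1, hμ.2]
  rw [blaschke_im, neg_ne_zero]
  positivity

theorem blaschke_conj (μ : ℝ) (z : ℂ) :
    blaschke μ (starRingEnd ℂ z) = starRingEnd ℂ (blaschke μ z) := by
  simp [blaschke]

theorem sqrtBlaschke_conj (hμ : μ ∈ Set.Ico (0 : ℝ) 1) {z : ℂ} (hz : z.im ≠ 0) :
    sqrtBlaschke μ (starRingEnd ℂ z) = starRingEnd ℂ (sqrtBlaschke μ z) := by
  have harg : (blaschke μ z).arg ≠ Real.pi := fun h =>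
    blaschke_im_ne_zero hμ hz (Complex.arg_eq_pi_iff.mp h).2
  rw [sqrtBlaschke, blaschke_conj, Complex.log_conj _ harg, sqrtBlaschke, ← Complex.exp_conj,
    map_div₀, map_ofNat]

theorem sqrtBlaschke_ne_zero (μ : ℝ) (z : ℂ) : sqrtBlaschke μ z ≠ 0 := Complex.exp_ne_zero _

theorem sqrtBlaschke_sq {z : ℂ} (hz : blaschke μ z ≠ 0) : sqrtBlaschke μ z ^ 2 = blaschke μ z := by
  rw [sqrtBlaschke, ← Complex.exp_nat_mul]
  push_cast
  rw [mul_div_cancel₀ _ (two_ne_zero), Complex.exp_log hz]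

theorem norm_sqrtBlaschke {z : ℂ} (hz : blaschke μ z ≠ 0) :
    ‖sqrtBlaschke μ z‖ = √‖blaschke μ z‖ := by
  rw [← sqrtBlaschke_sq hz, norm_pow, Real.sqrt_sq (norm_nonneg _)]

theorem norm_sub_le_norm_one_sub_mul (hμ : μ ∈ Set.Ico (0 : ℝ) 1) {z : ℂ} (hz : ‖z‖ ≤ 1) :
    ‖(μ : ℂ) - z‖ ≤ ‖(1 : ℂ) - μ * z‖ := by
  rw [← sq_le_sq₀ (norm_nonneg _) (norm_nonneg _), ← Complex.normSq_eq_norm_sq,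
    ← Complex.normSq_eq_norm_sq]
  have h1 : Complex.normSq z ≤ 1 := by
    rw [Complex.normSq_eq_norm_sq]
    exact pow_le_one₀ (norm_nonneg _) hz
  rw [Complex.normSq_apply] at h1 ⊢
  rw [Complex.normSq_apply]
  simp
  have h2 : 0 ≤ 1 - μ ^ 2 := by nlinarith [hμ.1, hμ.2]
  nlinarith [mul_nonneg h2 (sub_nonneg.mpr h1)]

theorem norm_blaschke_le_one (hμ : μ ∈ Set.Ico (0 : ℝ) 1) {z : ℂ} (hz : ‖z‖ ≤ 1) :
    ‖blaschke μ z‖ ≤ 1 := by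
  rw [blaschke, norm_div]
  exact div_le_one_of_le₀ (norm_sub_le_norm_one_sub_mul hμ hz) (norm_nonneg _)

theorem le_norm_blaschke (hμ : μ ∈ Set.Ico (0 : ℝ) 1) {z : ℂ} (hz : ‖z‖ ≤ 1) :
    |‖z‖ - μ| / 2 ≤ ‖blaschke μ z‖ := by
  rw [blaschke, norm_div]
  have h0 : 0 < ‖(1 : ℂ) - μ * z‖ := norm_pos_iff.mpr (one_sub_mul_ne_zero hμ (Or.inr hz))
  have h1 : ‖(1 : ℂ) - μ * z‖ ≤ 2 := by
    refine (norm_sub_le _ _).trans ?_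
    rw [norm_one, norm_mul, Complex.norm_real, Real.norm_eq_abs, abs_of_nonneg hμ.1]
    nlinarith [hμ.1, hμ.2, norm_nonneg z]
  have h2 : |‖z‖ - μ| ≤ ‖(μ : ℂ) - z‖ := by
    have := abs_norm_sub_norm_le z (μ : ℂ)
    rwa [Complex.norm_real, Real.norm_eq_abs, abs_of_nonneg hμ.1, norm_sub_rev] at this
  exact div_le_div₀ (norm_nonneg _) h2 h0 h1

theorem differentiableAt_sqrtBlaschke (hμ : μ ∈ Set.Ico (0 : ℝ) 1) {z : ℂ} (hz : z.im ≠ 0) :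
    DifferentiableAt ℂ (sqrtBlaschke μ) z := by
  have h1 : DifferentiableAt ℂ (blaschke μ) z :=
    DifferentiableAt.div (by fun_prop) (by fun_prop) (one_sub_mul_ne_zero hμ (Or.inl hz))
  exact ((h1.clog (Or.inr (blaschke_im_ne_zero hμ hz))).div_const 2).cexp

theorem continuousAt_blaschke (hμ : μ ∈ Set.Ico (0 : ℝ) 1) {x : ℝ} (hx : x ∈ Set.Ioo (-1 : ℝ) 1) :
    ContinuousAt (blaschke μ) (x : ℂ) :=
  ContinuousAt.div (by fun_prop) (by fun_prop)
    (one_sub_mul_ne_zero hμ (Or.inr (norm_ofReal_lt_one hx).le))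

theorem blaschke_ofReal (μ x : ℝ) : blaschke μ x = (((μ - x) / (1 - μ * x) : ℝ) : ℂ) := by
  rw [blaschke]
  push_cast
  rfl

theorem one_sub_mul_pos (hμ : μ ∈ Set.Ico (0 : ℝ) 1) {x : ℝ} (hx : x ∈ Set.Ioo (-1 : ℝ) 1) :
    0 < 1 - μ * x := by
  nlinarith [hμ.1, hμ.2, hx.1, hx.2]

theorem exp_half_log_eq_sqrt {r : ℝ} (hr : 0 < r) : Real.exp (Real.log r / 2) = √r := by
  rw [← Real.log_sqrt hr.le, Real.exp_log (Real.sqrt_pos.mpr hr)]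

/-- The Blaschke factor maps the upper half plane to the lower one, so that on `(μ, 1)` its square
root approaches the negative imaginary axis. -/
theorem tendsto_sqrtBlaschke (hμ : μ ∈ Set.Ico (0 : ℝ) 1) {x : ℝ} (hx : x ∈ Set.Ioo (-1 : ℝ) 1)
    (hxμ : x ≠ μ) :
    Tendsto (sqrtBlaschke μ) (𝓝[upperHalf] (x : ℂ)) (𝓝 (sqrtBlaschkeBoundary μ x)) := by
  have hd := one_sub_mul_pos hμ hx
  have hc := (continuousAt_blaschke hμ hx).tendsto
  rw [blaschke_ofReal] at hc
  rcases hxμ.lt_or_gt with h | h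
  · rw [sqrtBlaschkeBoundary, if_pos h.le]
    have hpos : 0 < (μ - x) / (1 - μ * x) := div_pos (by linarith) hd
    have h1 := (hc.clog (Or.inl (by rw [Complex.ofReal_re]; exact hpos))).div_const 2
    have h2 := h1.cexp
    rw [← Complex.ofReal_log hpos.le, show ((Real.log ((μ - x) / (1 - μ * x)) : ℝ) : ℂ) / 2
      = ((Real.log ((μ - x) / (1 - μ * x)) / 2 : ℝ) : ℂ) by push_cast; rfl, ← Complex.ofReal_exp,
      exp_half_log_eq_sqrt hpos] at h2
    exact h2.mono_left nhdsWithin_le_nhds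
  · rw [sqrtBlaschkeBoundary, if_neg (not_le.mpr h)]
    have hpos : 0 < (x - μ) / (1 - μ * x) := div_pos (by linarith) hd
    have heq : (μ - x) / (1 - μ * x) = -((x - μ) / (1 - μ * x)) := by
      rw [← neg_div, neg_sub]
    have hneg : (μ - x) / (1 - μ * x) < 0 := by rw [heq]; linarith
    have hc2 : Tendsto (blaschke μ) (𝓝[upperHalf] (x : ℂ))
        (𝓝[{ z : ℂ | z.im < 0 }] (((μ - x) / (1 - μ * x) : ℝ) : ℂ)) :=
      tendsto_nhdsWithin_iff.mpr ⟨hc.mono_left nhdsWithin_le_nhds,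
        eventually_nhdsWithin_of_forall fun z hz => blaschke_im_neg hμ hz⟩
    have h1 := ((Complex.tendsto_log_nhdsWithin_im_neg_of_re_neg_of_im_zero
      (by rw [Complex.ofReal_re]; exact hneg) (Complex.ofReal_im _)).comp hc2).div_const 2
    have h2 := h1.cexp
    have hval : Complex.exp (((Real.log ‖(((μ - x) / (1 - μ * x) : ℝ) : ℂ)‖ : ℝ) -
        Real.pi * Complex.I) / 2) = -(√((x - μ) / (1 - μ * x)) : ℝ) * Complex.I := by
      rw [Complex.norm_real, Real.norm_eq_abs, abs_of_neg hneg, heq, neg_neg, sub_div,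
        Complex.exp_sub, show ((Real.log ((x - μ) / (1 - μ * x)) : ℝ) : ℂ) / 2
        = ((Real.log ((x - μ) / (1 - μ * x)) / 2 : ℝ) : ℂ) by push_cast; rfl, ← Complex.ofReal_exp,
        exp_half_log_eq_sqrt hpos, mul_div_right_comm, Complex.exp_pi_div_two_mul_I]
      simp
    rw [hval] at h2
    exact h2

theorem neg_conj_mem_upperHalf {z : ℂ} (hz : z ∈ upperHalf) : -starRingEnd ℂ z ∈ upperHalf := by
  simpa [upperHalf] using hz

/-- Reflection in the imaginary axis, which reduces boundary values of `z ↦ sqrtBlaschke μ (-z)` to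
those of `sqrtBlaschke μ`. -/
theorem sqrtBlaschke_neg (hμ : μ ∈ Set.Ico (0 : ℝ) 1) {z : ℂ} (hz : z ∈ upperHalf) :
    sqrtBlaschke μ (-z) = starRingEnd ℂ (sqrtBlaschke μ (-starRingEnd ℂ z)) := by
  rw [← sqrtBlaschke_conj hμ (ne_of_gt (neg_conj_mem_upperHalf hz))]
  simp

theorem tendsto_sqrtBlaschke_neg (hμ : μ ∈ Set.Ico (0 : ℝ) 1) {x : ℝ} (hx : x ∈ Set.Ioo (-1 : ℝ) 1)
    (hxμ : -x ≠ μ) :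
    Tendsto (fun z => sqrtBlaschke μ (-z)) (𝓝[upperHalf] (x : ℂ))
      (𝓝 (starRingEnd ℂ (sqrtBlaschkeBoundary μ (-x)))) := by
  have h1 : Tendsto (fun z : ℂ => -starRingEnd ℂ z) (𝓝[upperHalf] (x : ℂ))
      (𝓝[upperHalf] ((-x : ℝ) : ℂ)) := by
    refine tendsto_nhdsWithin_iff.mpr ⟨?_,
      eventually_nhdsWithin_of_forall fun z hz => neg_conj_mem_upperHalf hz⟩
    have hc : Continuous fun z : ℂ => -starRingEnd ℂ z := Complex.continuous_conj.neg
    have h2 := hc.tendsto (x : ℂ)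
    rw [Complex.conj_ofReal, ← Complex.ofReal_neg] at h2
    exact h2.mono_left nhdsWithin_le_nhds
  have h2 := (tendsto_sqrtBlaschke hμ (x := -x)
    ⟨by linarith [hx.2], by linarith [hx.1]⟩ hxμ).comp h1
  refine ((Complex.continuous_conj.tendsto _).comp h2).congr' ?_
  exact eventually_nhdsWithin_of_forall fun z hz => (sqrtBlaschke_neg hμ hz).symm

theorem sqrtBlaschkeBoundary_ne_zero (hμ : μ ∈ Set.Ico (0 : ℝ) 1) {x : ℝ}
    (hx : x ∈ Set.Ioo (-1 : ℝ) 1) (hxμ : x ≠ μ) : sqrtBlaschkeBoundary μ x ≠ 0 := by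
  have hd := one_sub_mul_pos hμ hx
  rcases hxμ.lt_or_gt with h | h
  · rw [sqrtBlaschkeBoundary, if_pos h.le]
    exact_mod_cast (Real.sqrt_pos.mpr (div_pos (by linarith) hd)).ne'
  · rw [sqrtBlaschkeBoundary, if_neg (not_le.mpr h)]
    have h1 : ((√((x - μ) / (1 - μ * x)) : ℝ) : ℂ) ≠ 0 := by
      exact_mod_cast (Real.sqrt_pos.mpr (div_pos (by linarith) hd)).ne'
    exact mul_ne_zero (neg_ne_zero.mpr h1) Complex.I_ne_zero

/-! ### The symbols as boundary values -/

theorem norm_sqrtBlaschke_sub_one_le (hμ : μ ∈ Set.Ico (0 : ℝ) 1) {z : ℂ} (hz : z ∈ upperHalf)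
    (hz1 : ‖z‖ ≤ 1) : ‖sqrtBlaschke μ z - 1‖ ≤ 2 := by
  have h0 : blaschke μ z ≠ 0 := fun h => by
    have h1 := blaschke_im_neg hμ hz
    rw [h] at h1
    simp at h1
  refine (norm_sub_le _ _).trans ?_
  rw [norm_one, norm_sqrtBlaschke h0]
  have := Real.sqrt_le_one.mpr (norm_blaschke_le_one hμ hz1)
  linarith

theorem one_le_inv_sqrt (hμ : μ ∈ Set.Ico (0 : ℝ) 1) {z : ℂ} (hz1 : ‖z‖ ≤ 1) (hzμ : ‖z‖ ≠ μ) :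
    1 ≤ (√|‖z‖ - μ|)⁻¹ := by
  refine (one_le_inv₀ (Real.sqrt_pos.mpr (abs_pos.mpr (sub_ne_zero.mpr hzμ)))).mpr ?_
  refine Real.sqrt_le_one.mpr (abs_le.mpr ⟨?_, ?_⟩) <;> linarith [norm_nonneg z, hμ.1, hμ.2]

theorem norm_inv_sqrtBlaschke_sub_one_le (hμ : μ ∈ Set.Ico (0 : ℝ) 1) {z : ℂ}
    (hz1 : ‖z‖ ≤ 1) (hzμ : ‖z‖ ≠ μ) :
    ‖(sqrtBlaschke μ (-z))⁻¹ - 1‖ ≤ 3 * (√|‖z‖ - μ|)⁻¹ := by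
  have hpos : 0 < |‖z‖ - μ| := abs_pos.mpr (sub_ne_zero.mpr hzμ)
  have h1 := le_norm_blaschke hμ (z := -z) (by rwa [norm_neg])
  rw [norm_neg] at h1
  have h0 : blaschke μ (-z) ≠ 0 := fun h => by
    rw [h, norm_zero] at h1
    linarith
  refine (norm_sub_le _ _).trans ?_
  rw [norm_one, norm_inv, norm_sqrtBlaschke h0]
  have h2 : (√‖blaschke μ (-z)‖)⁻¹ ≤ 2 * (√|‖z‖ - μ|)⁻¹ := by
    have h3 : √|‖z‖ - μ| / 2 ≤ √‖blaschke μ (-z)‖ := by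
      refine Real.le_sqrt_of_sq_le ?_
      rw [div_pow, Real.sq_sqrt hpos.le]
      linarith
    refine (inv_anti₀ (by positivity) h3).trans (le_of_eq ?_)
    rw [inv_div, div_eq_mul_inv]
  linarith [one_le_inv_sqrt hμ hz1 hzμ]

theorem hasBoundaryValues_pos (hμ : μ ∈ Set.Ico (0 : ℝ) 1) :
    HasBoundaryValues μ (fun z => sqrtBlaschke μ z - 1)
      (fun x => sqrtBlaschkeBoundary μ x - 1) where
  differentiableOn z hz :=
    ((differentiableAt_sqrtBlaschke hμ (ne_of_gt hz)).sub_const 1).differentiableWithinAt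
  bound := by
    refine ⟨2, fun z hz hz1 hzμ => (norm_sqrtBlaschke_sub_one_le hμ hz hz1).trans ?_⟩
    linarith [one_le_inv_sqrt hμ hz1 hzμ]
  tendsto x hx _ hxμ := (tendsto_sqrtBlaschke hμ hx fun h => hxμ (by
    rw [h, abs_of_nonneg hμ.1])).sub_const 1

theorem hasBoundaryValues_neg (hμ : μ ∈ Set.Ico (0 : ℝ) 1) :
    HasBoundaryValues μ (fun z => (sqrtBlaschke μ (-z))⁻¹ - 1)
      (fun x => (starRingEnd ℂ (sqrtBlaschkeBoundary μ (-x)))⁻¹ - 1) where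
  differentiableOn z hz := by
    have h1 : DifferentiableAt ℂ (fun z => sqrtBlaschke μ (-z)) z :=
      (differentiableAt_sqrtBlaschke hμ (z := -z)
        (by simpa using ne_of_gt hz)).comp z differentiableAt_id.neg
    exact ((h1.inv (sqrtBlaschke_ne_zero _ _)).sub_const 1).differentiableWithinAt
  bound := ⟨3, fun _ _ hz1 hzμ => norm_inv_sqrtBlaschke_sub_one_le hμ hz1 hzμ⟩
  tendsto x hx _ hxμ := by
    have hne : -x ≠ μ := fun h => hxμ (by rw [← abs_neg, h, abs_of_nonneg hμ.1])
    refine ((tendsto_sqrtBlaschke_neg hμ hx hne).inv₀ ?_).sub_const 1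
    exact (map_ne_zero _).mpr (sqrtBlaschkeBoundary_ne_zero hμ
      ⟨by linarith [hx.2], by linarith [hx.1]⟩ hne)

theorem hasBoundaryValues_mul (hμ : μ ∈ Set.Ico (0 : ℝ) 1) :
    HasBoundaryValues μ (fun z => (sqrtBlaschke μ z - 1) * ((sqrtBlaschke μ (-z))⁻¹ - 1))
      (fun x => (sqrtBlaschkeBoundary μ x - 1) *
        ((starRingEnd ℂ (sqrtBlaschkeBoundary μ (-x)))⁻¹ - 1)) where
  differentiableOn :=
    (hasBoundaryValues_pos hμ).differentiableOn.mul (hasBoundaryValues_neg hμ).differentiableOn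
  bound := by
    refine ⟨2 * 3, fun z hz hz1 hzμ => ?_⟩
    rw [norm_mul, mul_assoc]
    exact mul_le_mul (norm_sqrtBlaschke_sub_one_le hμ hz hz1)
      (norm_inv_sqrtBlaschke_sub_one_le hμ hz1 hzμ) (norm_nonneg _) zero_le_two
  tendsto x hx hx0 hxμ :=
    ((hasBoundaryValues_pos hμ).tendsto x hx hx0 hxμ).mul
      ((hasBoundaryValues_neg hμ).tendsto x hx hx0 hxμ)

/-! ### The jump functions on the upper half circle -/

theorem norm_blaschke_circle (hμ : μ ∈ Set.Ico (0 : ℝ) 1) (t : Circle) : ‖blaschke μ t‖ = 1 := by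
  rw [← norm_mobius hμ t, blaschke, ← norm_neg, ← neg_div, neg_sub]

/-- `u_{β,τ}(t) = (-t/τ) ^ β` with the principal branch. -/
theorem jump_eq (β : ℂ) (τ t : Circle) :
    jump β τ t = Complex.exp (β * Complex.log (-((t : ℂ) / τ))) := by
  have h : ‖-((t : ℂ) / τ)‖ = 1 := by
    rw [norm_neg, norm_div, Circle.norm_coe, Circle.norm_coe, div_one]
  rw [jump, Complex.log, h, Real.log_one]
  simp
  ring_nf

theorem psiPos_eq (μ : Set.Ico (0 : ℝ) 1) (t : Circle) :
    psiPos μ t = (sqrtBlaschke μ t)⁻¹ - 1 := by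
  have h : -(((mobius μ 1 t : Circle) : ℂ) / ((1 : Circle) : ℂ)) = blaschke μ t := by
    simp [mobius, blaschke, ← neg_div]
  rw [psiPos, mobiusPullback, Pi.sub_apply, jump_eq, h, sqrtBlaschke, ← Complex.exp_neg,
    Pi.one_apply]
  congr 2
  ring

theorem psiNeg_eq (μ : Set.Ico (0 : ℝ) 1) (t : Circle) :
    psiNeg μ t = sqrtBlaschke μ (-t) - 1 := by
  have h : -(((mobius μ (-1) t : Circle) : ℂ) / ((1 : Circle) : ℂ)) = blaschke μ (-t) := by
    simp [mobius, blaschke, ← neg_div]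
  rw [psiNeg, mobiusPullback, Pi.sub_apply, jump_eq, h, sqrtBlaschke, Pi.one_apply]
  congr 2
  ring

theorem inv_sqrtBlaschke_circle (hμ : μ ∈ Set.Ico (0 : ℝ) 1) (t : Circle) :
    (sqrtBlaschke μ t)⁻¹ = starRingEnd ℂ (sqrtBlaschke μ t) := by
  have h0 := norm_blaschke_circle hμ t
  have h1 : ‖sqrtBlaschke μ t‖ = 1 := by
    rw [norm_sqrtBlaschke (fun h => by simp [h] at h0), h0, Real.sqrt_one]
  exact Complex.inv_eq_conj h1

theorem im_circle_exp_pos {θ : ℝ} (hθ : θ ∈ Set.Ioo 0 Real.pi) :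
    0 < ((Circle.exp θ : Circle) : ℂ).im := by
  rw [Circle.coe_exp]
  exact exp_mem_upperHalf (by simpa using hθ.1) (by simpa using hθ.2)

theorem psiPos_exp (μ : Set.Ico (0 : ℝ) 1) (θ : ℝ) :
    psiPos μ (Circle.exp θ) = starRingEnd ℂ (sqrtBlaschke μ (Complex.exp (θ * Complex.I)) - 1) := by
  rw [psiPos_eq, inv_sqrtBlaschke_circle μ.2, Circle.coe_exp, map_sub, map_one]

theorem psiPos_exp_neg (μ : Set.Ico (0 : ℝ) 1) {θ : ℝ} (hθ : θ ∈ Set.Ioo 0 Real.pi) :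
    psiPos μ (Circle.exp (-θ)) = sqrtBlaschke μ (Complex.exp (θ * Complex.I)) - 1 := by
  rw [psiPos_eq, inv_sqrtBlaschke_circle μ.2, Circle.exp_neg, Circle.coe_inv_eq_conj,
    sqrtBlaschke_conj μ.2 (im_circle_exp_pos hθ).ne', Complex.conj_conj, Circle.coe_exp]

theorem inv_sqrtBlaschke_neg_circle (hμ : μ ∈ Set.Ico (0 : ℝ) 1) (t : Circle) :
    (sqrtBlaschke μ (-t))⁻¹ = starRingEnd ℂ (sqrtBlaschke μ (-t)) := by
  have := inv_sqrtBlaschke_circle hμ (-t)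
  simpa using this

theorem psiNeg_exp (μ : Set.Ico (0 : ℝ) 1) (θ : ℝ) :
    psiNeg μ (Circle.exp θ) =
      starRingEnd ℂ ((sqrtBlaschke μ (-Complex.exp (θ * Complex.I)))⁻¹ - 1) := by
  rw [psiNeg_eq, ← Circle.coe_exp, inv_sqrtBlaschke_neg_circle μ.2, map_sub, map_one,
    Complex.conj_conj]

theorem psiNeg_exp_neg (μ : Set.Ico (0 : ℝ) 1) {θ : ℝ} (hθ : θ ∈ Set.Ioo 0 Real.pi) :
    psiNeg μ (Circle.exp (-θ)) = (sqrtBlaschke μ (-Complex.exp (θ * Complex.I)))⁻¹ - 1 := by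
  have h := im_circle_exp_pos hθ
  rw [psiNeg_eq, ← Circle.coe_exp, inv_sqrtBlaschke_neg_circle μ.2, Circle.exp_neg,
    Circle.coe_inv_eq_conj, ← map_neg, sqrtBlaschke_conj μ.2 (by simpa using h.ne')]

end Blaschke

/-! ### The densities -/

section Densities

/-- A majorant on `(-1, 1)`, supported in `(μ, 1)`, with inverse square root singularities at both
ends of the support. -/
def endpointBound (μ a c x : ℝ) : ℝ :=
  (Set.Ioo μ 1).indicator (fun x => a * (√(x - μ))⁻¹ + c * (√(1 - x))⁻¹) x

variable {μ a c : ℝ}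

theorem intervalIntegrable_endpoint (hμ : μ ∈ Set.Ico (0 : ℝ) 1) (a c : ℝ) :
    IntervalIntegrable (fun x => a * (√(x - μ))⁻¹ + c * (√(1 - x))⁻¹) volume μ 1 :=
  ((intervalIntegrable_inv_sqrt_sub_left hμ.2.le).const_mul a).add
    ((intervalIntegrable_inv_sqrt_sub_right hμ.2.le).const_mul c)

theorem integrableOn_endpointBound (hμ : μ ∈ Set.Ico (0 : ℝ) 1) (a c : ℝ) :
    IntegrableOn (endpointBound μ a c) (Set.Ioo (-1 : ℝ) 1) := by
  have h := (intervalIntegrable_iff_integrableOn_Ioo_of_le hμ.2.le).mp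
    (intervalIntegrable_endpoint hμ a c)
  exact (h.integrable_indicator measurableSet_Ioo).integrableOn

theorem integral_endpointBound (hμ : μ ∈ Set.Ico (0 : ℝ) 1) (a c : ℝ) :
    ∫ x in Set.Ioo (-1 : ℝ) 1, endpointBound μ a c x = 2 * (a + c) * √(1 - μ) := by
  have h1 : Set.Ioo (-1 : ℝ) 1 ∩ Set.Ioo μ 1 = Set.Ioo μ 1 :=
    Set.inter_eq_right.mpr (Set.Ioo_subset_Ioo_left (by linarith [hμ.1]))
  simp_rw [endpointBound]
  rw [setIntegral_indicator measurableSet_Ioo, h1, ← integral_Ioc_eq_integral_Ioo,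
    ← intervalIntegral.integral_of_le hμ.2.le, intervalIntegral.integral_add
    ((intervalIntegrable_inv_sqrt_sub_left hμ.2.le).const_mul a)
    ((intervalIntegrable_inv_sqrt_sub_right hμ.2.le).const_mul c),
    intervalIntegral.integral_const_mul, intervalIntegral.integral_const_mul,
    integral_inv_sqrt_sub_left hμ.2.le, integral_inv_sqrt_sub_right hμ.2.le]
  ring

theorem integral_le_of_le_endpointBound (hμ : μ ∈ Set.Ico (0 : ℝ) 1) {f : ℝ → ℝ}
    (hf : Measurable f) (hf0 : ∀ x, 0 ≤ f x)
    (hle : ∀ x ∈ Set.Ioo (-1 : ℝ) 1, f x ≤ endpointBound μ a c x + endpointBound μ a c (-x)) :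
    IntegrableOn f (Set.Ioo (-1 : ℝ) 1) ∧
      ∫ x in Set.Ioo (-1 : ℝ) 1, f x ≤ 4 * (a + c) * √(1 - μ) := by
  have h1 := integrableOn_endpointBound hμ a c
  have hpre : (fun x : ℝ => -x) ⁻¹' Set.Ioo (-1) 1 = Set.Ioo (-1) 1 := by
    ext x
    simp only [Set.mem_preimage, Set.mem_Ioo]
    constructor <;> rintro ⟨h, h'⟩ <;> constructor <;> linarith
  have hmp := (Measure.measurePreserving_neg (volume : Measure ℝ)).restrict_preimage
    (measurableSet_Ioo (a := (-1 : ℝ)) (b := 1))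
  rw [hpre] at hmp
  have hemb := (MeasurableEquiv.neg ℝ).measurableEmbedding
  have h2 : IntegrableOn (fun x => endpointBound μ a c (-x)) (Set.Ioo (-1 : ℝ) 1) :=
    (hmp.integrable_comp_emb hemb).mpr h1
  have h3 : ∫ x in Set.Ioo (-1 : ℝ) 1, endpointBound μ a c (-x) = 2 * (a + c) * √(1 - μ) := by
    rw [← integral_endpointBound hμ a c]
    exact hmp.integral_comp hemb _
  have hi : IntegrableOn f (Set.Ioo (-1 : ℝ) 1) := by
    refine (h1.add h2).mono' hf.aestronglyMeasurable ?_
    refine (ae_restrict_iff' measurableSet_Ioo).mpr (Eventually.of_forall fun x hx => ?_)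
    rw [Real.norm_eq_abs, abs_of_nonneg (hf0 x)]
    exact hle x hx
  refine ⟨hi, (setIntegral_mono_on hi (h1.add h2) measurableSet_Ioo hle).trans (le_of_eq ?_)⟩
  rw [integral_add' h1 h2, integral_endpointBound hμ, h3]
  ring

/-- The modulus of the boundary values of `sqrtBlaschke` on its cut `(μ, 1)`. -/
def cutWeight (μ x : ℝ) : ℝ := √((x - μ) / (1 - μ * x))

theorem sqrtBlaschkeBoundary_of_le {x : ℝ} (hx : x ≤ μ) :
    sqrtBlaschkeBoundary μ x = (√((μ - x) / (1 - μ * x)) : ℝ) := if_pos hx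

theorem sqrtBlaschkeBoundary_of_lt {x : ℝ} (hx : μ < x) :
    sqrtBlaschkeBoundary μ x = -(cutWeight μ x : ℝ) * Complex.I := if_neg (not_le.mpr hx)

theorem measurable_sqrtBlaschkeBoundary (μ : ℝ) : Measurable (sqrtBlaschkeBoundary μ) := by
  refine Measurable.ite measurableSet_Iic ?_ ?_
  · exact Complex.measurable_ofReal.comp (by fun_prop)
  · exact (Complex.measurable_ofReal.comp (by fun_prop)).neg.mul_const _

/-- The density of the moment matrix of `H(ψ_μ^{(1)})`. -/
def densityPos (μ x : ℝ) : ℝ := -(sqrtBlaschkeBoundary μ x - 1).im / Real.pi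

/-- The density of the moment matrix of `H(ψ_μ^{(-1)})`. -/
def densityNeg (μ x : ℝ) : ℝ :=
  -((starRingEnd ℂ (sqrtBlaschkeBoundary μ (-x)))⁻¹ - 1).im / Real.pi

/-- The density of the moment matrix of `H(ψ_μ^{(1)} ψ_μ^{(-1)})`. -/
def densityMul (μ x : ℝ) : ℝ :=
  -((sqrtBlaschkeBoundary μ x - 1) *
    ((starRingEnd ℂ (sqrtBlaschkeBoundary μ (-x)))⁻¹ - 1)).im / Real.pi

theorem measurable_sqrtBlaschkeBoundary_neg (μ : ℝ) :
    Measurable fun x => (starRingEnd ℂ (sqrtBlaschkeBoundary μ (-x)))⁻¹ - 1 :=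
  (Complex.continuous_conj.measurable.comp
    ((measurable_sqrtBlaschkeBoundary μ).comp measurable_neg)).inv.sub_const 1

theorem measurable_densityPos (μ : ℝ) : Measurable (densityPos μ) :=
  (Complex.measurable_im.comp ((measurable_sqrtBlaschkeBoundary μ).sub_const 1)).neg.div_const _

theorem measurable_densityNeg (μ : ℝ) : Measurable (densityNeg μ) :=
  (Complex.measurable_im.comp (measurable_sqrtBlaschkeBoundary_neg μ)).neg.div_const _

theorem measurable_densityMul (μ : ℝ) : Measurable (densityMul μ) :=
  (Complex.measurable_im.comp (((measurable_sqrtBlaschkeBoundary μ).sub_const 1).mul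
    (measurable_sqrtBlaschkeBoundary_neg μ))).neg.div_const _

theorem densityPos_of_le {x : ℝ} (hx : x ≤ μ) : densityPos μ x = 0 := by
  rw [densityPos, sqrtBlaschkeBoundary_of_le hx]
  simp

theorem densityPos_of_lt {x : ℝ} (hx : μ < x) : densityPos μ x = cutWeight μ x / Real.pi := by
  rw [densityPos, sqrtBlaschkeBoundary_of_lt hx]
  simp

theorem densityNeg_of_le {x : ℝ} (hx : -x ≤ μ) : densityNeg μ x = 0 := by
  rw [densityNeg, sqrtBlaschkeBoundary_of_le hx, Complex.conj_ofReal, ← Complex.ofReal_inv]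
  simp

theorem inv_conj_sqrtBlaschkeBoundary_of_lt {x : ℝ} (hx : μ < x) :
    (starRingEnd ℂ (sqrtBlaschkeBoundary μ x))⁻¹ =
      -((cutWeight μ x)⁻¹ : ℝ) * Complex.I := by
  rw [sqrtBlaschkeBoundary_of_lt hx]
  simp [mul_comm]

theorem densityNeg_of_lt {x : ℝ} (hx : μ < -x) :
    densityNeg μ x = (cutWeight μ (-x))⁻¹ / Real.pi := by
  rw [densityNeg, inv_conj_sqrtBlaschkeBoundary_of_lt hx]
  simp

theorem densityMul_of_abs_le {x : ℝ} (hx : x ≤ μ) (hx' : -x ≤ μ) : densityMul μ x = 0 := by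
  rw [densityMul, sqrtBlaschkeBoundary_of_le hx, sqrtBlaschkeBoundary_of_le hx',
    Complex.conj_ofReal, ← Complex.ofReal_inv, ← Complex.ofReal_one, ← Complex.ofReal_sub,
    ← Complex.ofReal_sub, ← Complex.ofReal_mul, Complex.ofReal_im, neg_zero, zero_div]

theorem densityMul_of_lt (hμ : 0 ≤ μ) {x : ℝ} (hx : μ < x) :
    densityMul μ x = cutWeight μ x * ((√((μ + x) / (1 + μ * x)))⁻¹ - 1) / Real.pi := by
  rw [densityMul, sqrtBlaschkeBoundary_of_lt hx, sqrtBlaschkeBoundary_of_le (by linarith),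
    Complex.conj_ofReal, ← Complex.ofReal_inv, ← Complex.ofReal_one, ← Complex.ofReal_sub,
    Complex.im_mul_ofReal, sub_neg_eq_add, mul_neg, sub_neg_eq_add]
  simp

theorem densityMul_of_lt_neg (hμ : 0 ≤ μ) {x : ℝ} (hx : μ < -x) :
    densityMul μ x =
      (cutWeight μ (-x))⁻¹ * (√((μ + -x) / (1 + μ * -x)) - 1) / Real.pi := by
  rw [densityMul, inv_conj_sqrtBlaschkeBoundary_of_lt hx, sqrtBlaschkeBoundary_of_le (by linarith),
    ← Complex.ofReal_one, ← Complex.ofReal_sub, Complex.im_ofReal_mul,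
    show (μ - x) / (1 - μ * x) = (μ + -x) / (1 + μ * -x) by ring]
  generalize √((μ + -x) / (1 + μ * -x)) = r
  simp
  ring

end Densities

/-! ### Estimates of the densities -/

section Estimates

variable {μ x : ℝ}

theorem cutWeight_eq (hx : x ∈ Set.Ioo μ 1) :
    cutWeight μ x = √(x - μ) / √(1 - μ * x) :=
  Real.sqrt_div (by linarith [hx.1]) _

theorem sqrt_one_sub_pos (hx : x ∈ Set.Ioo μ 1) : 0 < √(1 - x) :=
  Real.sqrt_pos.mpr (by linarith [hx.2])

theorem sqrt_sub_pos (hx : x ∈ Set.Ioo μ 1) : 0 < √(x - μ) :=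
  Real.sqrt_pos.mpr (by linarith [hx.1])

theorem inv_sqrt_one_sub_sq_le (hμ : 0 ≤ μ) (hx : x ∈ Set.Ioo μ 1) :
    (√(1 - x ^ 2))⁻¹ ≤ (√(1 - x))⁻¹ := by
  refine inv_anti₀ (sqrt_one_sub_pos hx) (Real.sqrt_le_sqrt ?_)
  nlinarith [hx.1, hx.2]

theorem cutWeight_mul_le (hμ : μ ∈ Set.Ico (0 : ℝ) 1) (hx : x ∈ Set.Ioo μ 1) :
    cutWeight μ x * (√(1 - x ^ 2))⁻¹ ≤ (√(1 - x))⁻¹ := by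
  have h1 : cutWeight μ x ≤ 1 := by
    refine Real.sqrt_le_one.mpr (div_le_one_of_le₀ ?_ ?_) <;> nlinarith [hμ.1, hμ.2, hx.1, hx.2]
  calc cutWeight μ x * (√(1 - x ^ 2))⁻¹ ≤ 1 * (√(1 - x))⁻¹ :=
        mul_le_mul h1 (inv_sqrt_one_sub_sq_le hμ.1 hx) (by positivity) zero_le_one
    _ = _ := one_mul _

theorem inv_cutWeight_mul_le (hμ : μ ∈ Set.Ico (0 : ℝ) 1) (hx : x ∈ Set.Ioo μ 1) :
    (cutWeight μ x)⁻¹ * (√(1 - x ^ 2))⁻¹ ≤ 2 * (√(x - μ))⁻¹ + (√(1 - x))⁻¹ := by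
  have hu := sqrt_one_sub_pos hx
  have hv := sqrt_sub_pos hx
  have hu2 := Real.sq_sqrt (show 0 ≤ 1 - x by linarith [hx.2])
  have hv2 := Real.sq_sqrt (show 0 ≤ x - μ by linarith [hx.1])
  have hs : √(1 - μ * x) ≤ 2 * √(1 - x) + √(x - μ) := by
    refine Real.sqrt_le_iff.mpr ⟨by positivity, ?_⟩
    -- `1 - μ x ≤ 2 (1 - x) + (x - μ)`
    nlinarith [hμ.1, hμ.2, hx.1, hx.2, mul_pos hu hv]
  rw [cutWeight_eq hx, inv_div]
  calc √(1 - μ * x) / √(x - μ) * (√(1 - x ^ 2))⁻¹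
      ≤ (2 * √(1 - x) + √(x - μ)) / √(x - μ) * (√(1 - x))⁻¹ :=
        mul_le_mul (div_le_div_of_nonneg_right hs hv.le) (inv_sqrt_one_sub_sq_le hμ.1 hx)
          (by positivity) (by positivity)
    _ = _ := by field_simp

theorem add_div_mem_Ioc (hμ : μ ∈ Set.Ico (0 : ℝ) 1) (hx : x ∈ Set.Ioo μ 1) :
    (μ + x) / (1 + μ * x) ∈ Set.Ioc (0 : ℝ) 1 := by
  have h0 : 0 < 1 + μ * x := by nlinarith [hμ.1, hx.1]
  refine ⟨div_pos (by linarith [hμ.1, hx.1]) h0, (div_le_one h0).mpr ?_⟩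
  nlinarith [hμ.1, hμ.2, hx.1, hx.2]

theorem le_sqrt_self {r : ℝ} (hr : r ∈ Set.Ioc (0 : ℝ) 1) : r ≤ √r := by
  refine Real.le_sqrt_of_sq_le ?_
  nlinarith [hr.1, hr.2]

/-- The second factor is at most `(1 - μ) (1 - x) / (μ + x)`; its zero at `1` cancels the pole of
`(1 - x²)⁻¹`. -/
theorem cutWeight_mul_inv_sqrt_sub_one_le (hμ : μ ∈ Set.Ico (0 : ℝ) 1) (hx : x ∈ Set.Ioo μ 1) :
    cutWeight μ x * ((√((μ + x) / (1 + μ * x)))⁻¹ - 1) * (1 - x ^ 2)⁻¹ ≤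
      √(1 - μ) * (√(x - μ))⁻¹ := by
  have hm : 0 < √(1 - μ) := Real.sqrt_pos.mpr (by linarith [hμ.2])
  have hm2 := Real.sq_sqrt (show 0 ≤ 1 - μ by linarith [hμ.2])
  have hv := sqrt_sub_pos hx
  have hv2 := Real.sq_sqrt (show 0 ≤ x - μ by linarith [hx.1])
  have hρ := add_div_mem_Ioc hμ hx
  have hx0 : 0 < x := hμ.1.trans_lt hx.1
  have hd : 0 < 1 - x ^ 2 := by nlinarith [hx.2]
  have hsum : 0 < μ + x := by linarith [hμ.1]
  have h1 : (√((μ + x) / (1 + μ * x)))⁻¹ - 1 ≤ (1 - μ) * (1 - x) / (μ + x) := by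
    refine (sub_le_sub_right (inv_anti₀ hρ.1 (le_sqrt_self hρ)) 1).trans (le_of_eq ?_)
    rw [inv_div]
    field_simp
    ring
  have h2 : (1 - μ) * (1 - x) / (μ + x) * (1 - x ^ 2)⁻¹ ≤ (1 - μ) / (x - μ) := by
    rw [← div_eq_mul_inv, div_div, div_le_div_iff₀ (by positivity) (by linarith [hx.1])]
    have h3 : (1 - x) * (x - μ) ≤ (μ + x) * (1 - x ^ 2) := by
      have : (μ + x) * (1 - x ^ 2) = (1 - x) * ((μ + x) * (1 + x)) := by ring
      rw [this]
      refine mul_le_mul_of_nonneg_left ?_ (by linarith [hx.2])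
      nlinarith [hμ.1]
    rw [mul_assoc]
    exact mul_le_mul_of_nonneg_left h3 (by linarith [hμ.2])
  have h4 : cutWeight μ x ≤ √(x - μ) / √(1 - μ) := by
    rw [cutWeight_eq hx]
    refine div_le_div_of_nonneg_left hv.le hm (Real.sqrt_le_sqrt ?_)
    nlinarith [hμ.1, hx.2]
  rw [mul_assoc]
  calc cutWeight μ x * (((√((μ + x) / (1 + μ * x)))⁻¹ - 1) * (1 - x ^ 2)⁻¹)
      ≤ √(x - μ) / √(1 - μ) * ((1 - μ) / (x - μ)) := by
        refine mul_le_mul h4 ((mul_le_mul_of_nonneg_right h1 (by positivity)).trans h2) ?_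
          (by positivity)
        refine mul_nonneg (sub_nonneg.mpr ?_) (by positivity)
        exact (one_le_inv₀ (Real.sqrt_pos.mpr hρ.1)).mpr (Real.sqrt_le_one.mpr hρ.2)
    _ = √(x - μ) / √(1 - μ) * (√(1 - μ) ^ 2 / √(x - μ) ^ 2) := by rw [hm2, hv2]
    _ = _ := by field_simp

/-- The second factor is at most `(1 - μ) (1 - x)`; its zero at `1` cancels the pole of
`(1 - x²)⁻¹`. -/
theorem inv_cutWeight_mul_one_sub_sqrt_le (hμ : μ ∈ Set.Ico (0 : ℝ) 1) (hx : x ∈ Set.Ioo μ 1) :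
    (cutWeight μ x)⁻¹ * (1 - √((μ + x) / (1 + μ * x))) * (1 - x ^ 2)⁻¹ ≤
      √(1 - μ) * (√(x - μ))⁻¹ := by
  have hv := sqrt_sub_pos hx
  have hρ := add_div_mem_Ioc hμ hx
  have hx0 : 0 < x := hμ.1.trans_lt hx.1
  have hd : 0 < 1 - x ^ 2 := by nlinarith [hx.2]
  have hμx : 0 ≤ μ * x := mul_nonneg hμ.1 hx0.le
  have h1 : 1 - √((μ + x) / (1 + μ * x)) ≤ (1 - μ) * (1 - x) := by
    refine (sub_le_sub_left (le_sqrt_self hρ) 1).trans ?_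
    have h2 : 1 - (μ + x) / (1 + μ * x) = (1 - μ) * (1 - x) / (1 + μ * x) := by
      field_simp
      ring
    rw [h2]
    exact div_le_self (mul_nonneg (by linarith [hμ.2]) (by linarith [hx.2])) (by linarith)
  have h2 : (1 - μ) * (1 - x) * (1 - x ^ 2)⁻¹ ≤ √(1 - μ) := by
    have h3 : (1 - μ) * (1 - x) * (1 - x ^ 2)⁻¹ ≤ 1 - μ := by
      rw [mul_assoc]
      refine mul_le_of_le_one_right (by linarith [hμ.2]) ?_
      rw [← div_eq_mul_inv, div_le_one hd]
      nlinarith [hx.2]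
    exact h3.trans (le_sqrt_self ⟨by linarith [hμ.2], by linarith [hμ.1]⟩)
  have h4 : (cutWeight μ x)⁻¹ ≤ (√(x - μ))⁻¹ := by
    rw [cutWeight_eq hx, inv_div, div_eq_mul_inv]
    exact mul_le_of_le_one_left (by positivity) (Real.sqrt_le_one.mpr (by linarith))
  rw [mul_assoc, mul_comm (√(1 - μ))]
  refine mul_le_mul h4 ((mul_le_mul_of_nonneg_right h1 (by positivity)).trans h2) ?_ (by positivity)
  exact mul_nonneg (sub_nonneg.mpr (Real.sqrt_le_one.mpr hρ.2)) (by positivity)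

theorem endpointBound_nonneg {a c : ℝ} (ha : 0 ≤ a) (hc : 0 ≤ c) (μ x : ℝ) :
    0 ≤ endpointBound μ a c x :=
  Set.indicator_nonneg (fun x _ => by positivity) x

theorem endpointBound_of_mem {a c : ℝ} (hx : x ∈ Set.Ioo μ 1) :
    endpointBound μ a c x = a * (√(x - μ))⁻¹ + c * (√(1 - x))⁻¹ :=
  Set.indicator_of_mem hx _

theorem div_pi_le {r : ℝ} (hr : 0 ≤ r) : r / Real.pi ≤ r :=
  div_le_self hr (by linarith [Real.pi_gt_three])

theorem integral_densityPos_le (hμ : μ ∈ Set.Ico (0 : ℝ) 1) :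
    IntegrableOn (fun x => |densityPos μ x| * (√(1 - x ^ 2))⁻¹) (Set.Ioo (-1 : ℝ) 1) ∧
      ∫ x in Set.Ioo (-1 : ℝ) 1, |densityPos μ x| * (√(1 - x ^ 2))⁻¹ ≤
        4 * (0 + 1) * √(1 - μ) := by
  have hm := measurable_densityPos μ
  refine integral_le_of_le_endpointBound hμ (by fun_prop) (fun x => by positivity) fun x hx => ?_
  have h0 := endpointBound_nonneg (a := 0) (c := 1) le_rfl zero_le_one μ
  rcases le_or_gt x μ with h | h
  · rw [densityPos_of_le h, abs_zero, zero_mul]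
    exact add_nonneg (h0 _) (h0 _)
  · have hw : 0 ≤ cutWeight μ x := Real.sqrt_nonneg _
    rw [densityPos_of_lt h, abs_of_nonneg (div_nonneg hw Real.pi_pos.le)]
    refine le_trans ?_ (le_add_of_nonneg_right (h0 _))
    rw [endpointBound_of_mem ⟨h, hx.2⟩, zero_mul, zero_add, one_mul]
    exact (mul_le_mul_of_nonneg_right (div_pi_le hw) (by positivity)).trans
      (cutWeight_mul_le hμ ⟨h, hx.2⟩)

theorem integral_densityNeg_le (hμ : μ ∈ Set.Ico (0 : ℝ) 1) :
    IntegrableOn (fun x => |densityNeg μ x| * (√(1 - x ^ 2))⁻¹) (Set.Ioo (-1 : ℝ) 1) ∧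
      ∫ x in Set.Ioo (-1 : ℝ) 1, |densityNeg μ x| * (√(1 - x ^ 2))⁻¹ ≤
        4 * (2 + 1) * √(1 - μ) := by
  have hm := measurable_densityNeg μ
  refine integral_le_of_le_endpointBound hμ (by fun_prop) (fun x => by positivity) fun x hx => ?_
  have h0 := endpointBound_nonneg (a := 2) (c := 1) zero_le_two zero_le_one μ
  rcases le_or_gt (-x) μ with h | h
  · rw [densityNeg_of_le h, abs_zero, zero_mul]
    exact add_nonneg (h0 _) (h0 _)
  · have hw : 0 ≤ (cutWeight μ (-x))⁻¹ := inv_nonneg.mpr (Real.sqrt_nonneg _)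
    have hx1 : -x < 1 := by linarith [hx.1]
    rw [densityNeg_of_lt h, abs_of_nonneg (div_nonneg hw Real.pi_pos.le)]
    refine le_trans ?_ (le_add_of_nonneg_left (h0 _))
    rw [endpointBound_of_mem ⟨h, hx1⟩, one_mul, ← neg_sq x]
    exact (mul_le_mul_of_nonneg_right (div_pi_le hw) (by positivity)).trans
      (inv_cutWeight_mul_le hμ ⟨h, hx1⟩)

/-- The absolute value around `(1 - x²)⁻¹`, redundant on `(-1, 1)`, makes the integrand nonnegative
on the whole line. -/
theorem integral_densityMul_le (hμ : μ ∈ Set.Ico (0 : ℝ) 1) :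
    IntegrableOn (fun x => |densityMul μ x| * |(1 - x ^ 2)⁻¹|) (Set.Ioo (-1 : ℝ) 1) ∧
      ∫ x in Set.Ioo (-1 : ℝ) 1, |densityMul μ x| * |(1 - x ^ 2)⁻¹| ≤
        4 * (√(1 - μ) + 0) * √(1 - μ) := by
  have hm := measurable_densityMul μ
  refine integral_le_of_le_endpointBound hμ (by fun_prop) (fun x => by positivity) fun x hx => ?_
  have h0 := endpointBound_nonneg (Real.sqrt_nonneg (1 - μ)) le_rfl μ
  have hd : 0 ≤ (1 - x ^ 2)⁻¹ := inv_nonneg.mpr (one_sub_sq_pos hx).le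
  rw [abs_of_nonneg hd]
  rcases le_or_gt x μ with h | h
  · rcases le_or_gt (-x) μ with h' | h'
    · rw [densityMul_of_abs_le h h', abs_zero, zero_mul]
      exact add_nonneg (h0 _) (h0 _)
    · have hx1 : -x < 1 := by linarith [hx.1]
      have hw : 0 ≤ (cutWeight μ (-x))⁻¹ * (1 - √((μ + -x) / (1 + μ * -x))) :=
        mul_nonneg (inv_nonneg.mpr (Real.sqrt_nonneg _))
          (sub_nonneg.mpr (Real.sqrt_le_one.mpr (add_div_mem_Ioc hμ ⟨h', hx1⟩).2))
      rw [densityMul_of_lt_neg hμ.1 h', ← abs_neg, ← neg_div, ← mul_neg, neg_sub,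
        abs_of_nonneg (div_nonneg hw Real.pi_pos.le)]
      refine le_trans ?_ (le_add_of_nonneg_left (h0 _))
      have hle := inv_cutWeight_mul_one_sub_sqrt_le hμ ⟨h', hx1⟩
      rw [neg_sq] at hle
      rw [endpointBound_of_mem ⟨h', hx1⟩, zero_mul, add_zero]
      exact (mul_le_mul_of_nonneg_right (div_pi_le hw) hd).trans hle
  · have hw : 0 ≤ cutWeight μ x * ((√((μ + x) / (1 + μ * x)))⁻¹ - 1) := by
      have hρ := add_div_mem_Ioc hμ ⟨h, hx.2⟩
      exact mul_nonneg (Real.sqrt_nonneg _) (sub_nonneg.mpr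
        ((one_le_inv₀ (Real.sqrt_pos.mpr hρ.1)).mpr (Real.sqrt_le_one.mpr hρ.2)))
    rw [densityMul_of_lt hμ.1 h, abs_of_nonneg (div_nonneg hw Real.pi_pos.le)]
    refine le_trans ?_ (le_add_of_nonneg_right (h0 _))
    rw [endpointBound_of_mem ⟨h, hx.2⟩, zero_mul, add_zero]
    exact (mul_le_mul_of_nonneg_right (div_pi_le hw) hd).trans
      (cutWeight_mul_inv_sqrt_sub_one_le hμ ⟨h, hx.2⟩)

/-- The supports of the two densities lie on opposite sides of the origin. -/
theorem mul_nonpos_of_density_ne_zero (hμ : 0 ≤ μ) {y : ℝ} (hx : densityPos μ x ≠ 0)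
    (hy : densityNeg μ y ≠ 0) : x * y ≤ 0 := by
  have h1 : μ < x := not_le.mp fun h => hx (densityPos_of_le h)
  have h2 : μ < -y := not_le.mp fun h => hy (densityNeg_of_le h)
  exact mul_nonpos_of_nonneg_of_nonpos (by linarith) (by linarith)

end Estimates

/-! ### The three operators -/

section Operators

theorem hasMomentMatrix_psiPos (μ : Set.Ico (0 : ℝ) 1) :
    HasMomentMatrix hardyBasis (hankel (psiPos μ) (essBounded_psiPos μ)) (densityPos μ) :=
  (hasBoundaryValues_pos μ.2).hasMomentMatrix μ.2 _ (fun θ _ => psiPos_exp μ θ)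
    fun _ hθ => psiPos_exp_neg μ hθ

theorem hasMomentMatrix_psiNeg (μ : Set.Ico (0 : ℝ) 1) :
    HasMomentMatrix hardyBasis (hankel (psiNeg μ) (essBounded_psiNeg μ)) (densityNeg μ) :=
  (hasBoundaryValues_neg μ.2).hasMomentMatrix μ.2 _ (fun θ _ => psiNeg_exp μ θ)
    fun _ hθ => psiNeg_exp_neg μ hθ

theorem hasMomentMatrix_psiPos_mul_psiNeg (μ : Set.Ico (0 : ℝ) 1) :
    HasMomentMatrix hardyBasis (hankel (psiPos μ * psiNeg μ)
      ((essBounded_psiPos μ).mul (essBounded_psiNeg μ))) (densityMul μ) :=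
  (hasBoundaryValues_mul μ.2).hasMomentMatrix μ.2 _
    (fun θ _ => by rw [Pi.mul_apply, psiPos_exp, psiNeg_exp, map_mul])
    fun θ hθ => by rw [Pi.mul_apply, psiPos_exp_neg μ hθ, psiNeg_exp_neg μ hθ]

/-- The constant is `4 · 12`, the product of those in `integral_densityPos_le` and
`integral_densityNeg_le`. -/
theorem traceClass_hankel_psiPos_comp_psiNeg (μ : Set.Ico (0 : ℝ) 1) :
    IsTraceClass (hankel (psiPos μ) (essBounded_psiPos μ) ∘L
        hankel (psiNeg μ) (essBounded_psiNeg μ)) ∧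
      traceNorm (hankel (psiPos μ) (essBounded_psiPos μ) ∘L
        hankel (psiNeg μ) (essBounded_psiNeg μ)) ≤ ENNReal.ofReal (48 * (1 - μ)) := by
  obtain ⟨hp, hp'⟩ := integral_densityPos_le μ.2
  obtain ⟨hq, hq'⟩ := integral_densityNeg_le μ.2
  obtain ⟨h1, h2⟩ := (hasMomentMatrix_psiPos μ).comp_traceClass (hasMomentMatrix_psiNeg μ)
    (measurable_densityPos μ) (measurable_densityNeg μ) hp hq
    fun x y hx hy => mul_nonpos_of_density_ne_zero μ.2.1 hx hy
  refine ⟨h1, h2.trans (ENNReal.ofReal_le_ofReal ?_)⟩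
  refine (mul_le_mul hp' hq' (integral_nonneg fun x => by positivity) (by positivity)).trans
    (le_of_eq ?_)
  linear_combination 48 * Real.mul_self_sqrt (sub_nonneg.mpr μ.2.2.le)

theorem traceClass_hankel_psiNeg_comp_psiPos (μ : Set.Ico (0 : ℝ) 1) :
    IsTraceClass (hankel (psiNeg μ) (essBounded_psiNeg μ) ∘L
        hankel (psiPos μ) (essBounded_psiPos μ)) ∧
      traceNorm (hankel (psiNeg μ) (essBounded_psiNeg μ) ∘L
        hankel (psiPos μ) (essBounded_psiPos μ)) ≤ ENNReal.ofReal (48 * (1 - μ)) := by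
  obtain ⟨hp, hp'⟩ := integral_densityPos_le μ.2
  obtain ⟨hq, hq'⟩ := integral_densityNeg_le μ.2
  obtain ⟨h1, h2⟩ := (hasMomentMatrix_psiNeg μ).comp_traceClass (hasMomentMatrix_psiPos μ)
    (measurable_densityNeg μ) (measurable_densityPos μ) hq hp
    fun x y hx hy => by
      rw [mul_comm]
      exact mul_nonpos_of_density_ne_zero μ.2.1 hy hx
  refine ⟨h1, h2.trans (ENNReal.ofReal_le_ofReal ?_)⟩
  refine (mul_le_mul hq' hp' (integral_nonneg fun x => by positivity) (by positivity)).trans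
    (le_of_eq ?_)
  linear_combination 48 * Real.mul_self_sqrt (sub_nonneg.mpr μ.2.2.le)

theorem traceClass_hankel_psiPos_mul_psiNeg (μ : Set.Ico (0 : ℝ) 1) :
    IsTraceClass (hankel (psiPos μ * psiNeg μ)
        ((essBounded_psiPos μ).mul (essBounded_psiNeg μ))) ∧
      traceNorm (hankel (psiPos μ * psiNeg μ)
        ((essBounded_psiPos μ).mul (essBounded_psiNeg μ))) ≤ ENNReal.ofReal (4 * (1 - μ)) := by
  obtain ⟨hp, hp'⟩ := integral_densityMul_le μ.2
  have heq : Set.EqOn (fun x => |densityMul μ x| * |(1 - x ^ 2)⁻¹|)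
      (fun x => |densityMul μ x| * (1 - x ^ 2)⁻¹) (Set.Ioo (-1 : ℝ) 1) := fun x hx => by
    simp only
    rw [abs_of_nonneg (inv_nonneg.mpr (one_sub_sq_pos hx).le)]
  obtain ⟨h1, h2⟩ := (hasMomentMatrix_psiPos_mul_psiNeg μ).traceClass (measurable_densityMul μ)
    (hp.congr_fun heq measurableSet_Ioo)
  refine ⟨h1, h2.trans (ENNReal.ofReal_le_ofReal ?_)⟩
  rw [← setIntegral_congr_fun measurableSet_Ioo heq]
  refine hp'.trans (le_of_eq ?_)
  linear_combination 4 * Real.mul_self_sqrt (sub_nonneg.mpr μ.2.2.le)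

theorem tendsto_zero_of_le_mul_one_sub {F : Set.Ico (0 : ℝ) 1 → ℝ≥0∞} {C : ℝ}
    (hF : ∀ μ, F μ ≤ ENNReal.ofReal (C * (1 - μ))) :
    Tendsto F (comap Subtype.val (𝓝 1)) (𝓝 0) := by
  have hc : Continuous fun μ : ℝ => ENNReal.ofReal (C * (1 - μ)) :=
    ENNReal.continuous_ofReal.comp (by fun_prop)
  have h := (hc.tendsto 1).comp (tendsto_comap (f := fun μ : Set.Ico (0 : ℝ) 1 => (μ : ℝ)))
  simp only [sub_self, mul_zero, ENNReal.ofReal_zero] at h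
  exact tendsto_of_tendsto_of_tendsto_of_le_of_le tendsto_const_nhds h (fun _ => zero_le) hF

end Operators

end

end JumpHankel

open JumpHankel
theorem proposition2p8 :
    (∀ μ : Set.Ico (0 : ℝ) 1,
      IsTraceClass (hankel (psiPos μ) (essBounded_psiPos μ) ∘L
        hankel (psiNeg μ) (essBounded_psiNeg μ)) ∧
      IsTraceClass (hankel (psiNeg μ) (essBounded_psiNeg μ) ∘L
        hankel (psiPos μ) (essBounded_psiPos μ)) ∧
      IsTraceClass (hankel (psiPos μ * psiNeg μ)
        ((essBounded_psiPos μ).mul (essBounded_psiNeg μ)))) ∧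
    Tendsto (fun μ : Set.Ico (0 : ℝ) 1 =>
        traceNorm (hankel (psiPos μ) (essBounded_psiPos μ) ∘L
          hankel (psiNeg μ) (essBounded_psiNeg μ)))
      (comap Subtype.val (𝓝 1)) (𝓝 0) ∧
    Tendsto (fun μ : Set.Ico (0 : ℝ) 1 =>
        traceNorm (hankel (psiNeg μ) (essBounded_psiNeg μ) ∘L
          hankel (psiPos μ) (essBounded_psiPos μ)))
      (comap Subtype.val (𝓝 1)) (𝓝 0) ∧
    Tendsto (fun μ : Set.Ico (0 : ℝ) 1 =>
        traceNorm (hankel (psiPos μ * psiNeg μ)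
          ((essBounded_psiPos μ).mul (essBounded_psiNeg μ))))
      (comap Subtype.val (𝓝 1)) (𝓝 0) := by
  refine ⟨fun μ => ⟨(traceClass_hankel_psiPos_comp_psiNeg μ).1,
    (traceClass_hankel_psiNeg_comp_psiPos μ).1, (traceClass_hankel_psiPos_mul_psiNeg μ).1⟩,
    tendsto_zero_of_le_mul_one_sub fun μ => (traceClass_hankel_psiPos_comp_psiNeg μ).2,
    tendsto_zero_of_le_mul_one_sub fun μ => (traceClass_hankel_psiNeg_comp_psiPos μ).2,
    tendsto_zero_of_le_mul_one_sub fun μ => (traceClass_hankel_psiPos_mul_psiNeg μ).2⟩
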